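/- Let $k$ be a field. A pair $\{\Phi_1,\Phi_2\}$ of alternating $m\times m$ matrices over $k$ (i.e. $u\Phi_iu^{\mathrm{tr}}=0$ for all $u\in k^m$) represents the alternating bimap $\circ\colon k^m\times k^m\to k^2$, $u\circ v=(u\Phi_1v^{\mathrm{tr}},\,u\Phi_2v^{\mathrm{tr}})$. The pair is *indecomposable* if $m>0$ and $k^m$ is not the direct sum of two nonzero subspaces orthogonal to each other with respect to both forms; it is *sloped* if some linear combination $a\Phi_1+b\Phi_2$ $(a,b\in k)$ is invertible (i.e. after a change of basis of $k^2$ the first form is nondegenerate). For a sloped pair there is a basis of $k^m$ relative to which $\Phi_i=\begin{bmatrix}0&\Psi_i\\-\Psi_i^{\mathrm{tr}}&0\end{bmatrix}$ for $i=1,2$ with $\Psi_1,\Psi_2$ square, and its *generalized Pfaffian* is $\mathrm{Pf}(\Phi_1,\Phi_2)=\det(x\Psi_1+y\Psi_2)\in k[x,y]$, which is defined up to a nonzero scalar. An element $\hat\alpha=\left(\begin{bmatrix}a&b\\c&d\end{bmatrix},\tau\right)$ of $\Gamma\mathrm{L}(2,k)=\mathrm{GL}(2,k)\rtimes\mathrm{Gal}(k)$,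 where $\mathrm{Gal}(k)=\mathrm{Aut}(k)$, acts on row vectors $w\in k^2$ by $w\hat\alpha=w^\tau\begin{bmatrix}a&b\\c&d\end{bmatrix}$ and on polynomials by $f^{\hat\alpha}(x,y)=f^\tau(ax+by,\,cx+dy)$, where $f^\tau$ is obtained by applying $\tau$ to the coefficients of $f$. A *pseudo-isometry* $(\alpha,\hat\alpha)$ from a bimap $\circ$ on $V$ to a bimap $\bullet$ on $V'$, both with values in $k^2$, consists of a semilinear bijection $\alpha\colon V\to V'$ and $\hat\alpha\in\Gamma\mathrm{L}(2,k)$ with $u\alpha\bullet v\alpha=(u\circ v)\hat\alpha$ for all $u,v\in V$. **Theorem.** Let $\{\Phi_1,\Phi_2\}$ and $\{\Lambda_1,\Lambda_2\}$ be pairs of alternating forms over $k$, each written relative to a fully refined orthogonal decomposition: for $i=1,2$, $$\Phi_i=\mathrm{diag}\big(\Phi_i^{(1)},\dots,\Phi_i^{(s)}\big),\qquad \Lambda_i=\mathrm{diag}\big(\Lambda_i^{(1)},\dots,\Lambda_i^{(t)}\big),$$ where all the pairs $\{\Phi_1^{(j)},\Phi_2^{(j)}\}$ and $\{\Lambda_1^{(j)},\Lambda_2^{(j)}\}$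 are indecomposable and sloped. Let $\hat\alpha\in\Gamma\mathrm{L}(2,k)$. There is an $\alpha$ such that $(\alpha,\hat\alpha)$ is a pseudo-isometry from (the bimap of) $\{\Phi_1,\Phi_2\}$ to (the bimap of) $\{\Lambda_1,\Lambda_2\}$ if and only if $s=t$ and there is a permutation $\sigma$ of $\{1,\dots,s\}$ such that for all $i$ $$\mathrm{Pf}\big(\Phi_1^{(i)},\Phi_2^{(i)}\big)^{\hat\alpha}\equiv\mathrm{Pf}\big(\Lambda_1^{(i\sigma)},\Lambda_2^{(i\sigma)}\big)\pmod{k^\times}.$$ -/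

import Mathlib

open Matrix

/-- The bimap `k^ι × k^ι → k²`, `u ∘ v = (u Φ₁ vᵗ, u Φ₂ vᵗ)`, represented by a pair of matrices.
The pair `{Φ₁, Φ₂}` is written `(Φ 0, Φ 1)`. -/
def pairBimap {k : Type*} [Field k] {ι : Type*} [Fintype ι]
    (Φ : Fin 2 → Matrix ι ι k) (u v : ι → k) : Fin 2 → k :=
  fun i => u ⬝ᵥ (Φ i *ᵥ v)

/-- Both matrices of the pair are alternating: `u Φᵢ uᵗ = 0` for all `u`. -/
def IsAltPair {k : Type*} [Field k] {ι : Type*} [Fintype ι]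
    (Φ : Fin 2 → Matrix ι ι k) : Prop :=
  ∀ u : ι → k, pairBimap Φ u u = 0

/-- Orthogonally indecomposable pair: the space is nonzero and is not the direct sum of two nonzero
subspaces that are orthogonal with respect to both forms. -/
def IsIndecPair {k : Type*} [Field k] {ι : Type*} [Fintype ι]
    (Φ : Fin 2 → Matrix ι ι k) : Prop :=
  Nonempty ι ∧ ∀ U W : Submodule k (ι → k), IsCompl U W →
    (∀ u ∈ U, ∀ w ∈ W, pairBimap Φ u w = 0 ∧ pairBimap Φ w u = 0) → U = ⊥ ∨ W = ⊥

/-- Sloped pair: after a change of basis of the target `k²`, the first form is nondegenerate;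
that is, some `k`-linear combination of the two forms is nondegenerate. -/
def IsSlopedPair {k : Type*} [Field k] {ι : Type*} [Fintype ι] [DecidableEq ι]
    (Φ : Fin 2 → Matrix ι ι k) : Prop :=
  ∃ a b : k, (a • Φ 0 + b • Φ 1).det ≠ 0

/-- The block diagonal pair `Φᵢ = diag(Φᵢ⁽¹⁾, …, Φᵢ⁽ˢ⁾)`; the blocks are given by
`Φ j i = Φᵢ⁽ʲ⁾`. -/
def diagPair {k : Type*} [Field k] {s : ℕ} {d : Fin s → ℕ}
    (Φ : ∀ j : Fin s, Fin 2 → Matrix (Fin (d j)) (Fin (d j)) k) :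
    Fin 2 → Matrix (Σ j, Fin (d j)) (Σ j, Fin (d j)) k :=
  fun i => Matrix.blockDiagonal' (fun j => Φ j i)

/-- The generalized discriminant `disc(Ψ₁, Ψ₂) = det(x Ψ₁ + y Ψ₂)` in `k[x, y]`,
where `x = X 0`, `y = X 1`. -/
noncomputable def genDisc {k : Type*} [Field k] {ι : Type*} [Fintype ι] [DecidableEq ι]
    (Ψ : Fin 2 → Matrix ι ι k) : MvPolynomial (Fin 2) k :=
  (∑ i, (MvPolynomial.X i : MvPolynomial (Fin 2) k) • (Ψ i).map MvPolynomial.C).det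

/-- `f` is a generalized Pfaffian of the pair `Φ`: there is a basis of `k^ι`, split as a basis of
`E` followed by a basis of `F`, with `dim E = dim F`, relative to which
`Φᵢ = [0, Ψᵢ; -Ψᵢᵗ, 0]` for `i = 1, 2`, and `f = disc(Ψ₁, Ψ₂)`. -/
def IsGenPfaffian {k : Type*} [Field k] {ι : Type*} [Fintype ι]
    (Φ : Fin 2 → Matrix ι ι k) (f : MvPolynomial (Fin 2) k) : Prop :=
  ∃ (n : ℕ) (b : Module.Basis (Fin n ⊕ Fin n) k (ι → k)) (Ψ : Fin 2 → Matrix (Fin n) (Fin n) k),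
    (∀ i, (Matrix.of fun p q => pairBimap Φ (b p) (b q) i) =
      Matrix.fromBlocks 0 (Ψ i) (-(Ψ i)ᵀ) 0) ∧
    f = genDisc Ψ

/-- Congruence modulo `k^×`: equality up to a nonzero scalar factor. -/
def EqModScalars {k : Type*} [Field k] (f g : MvPolynomial (Fin 2) k) : Prop :=
  ∃ c : k, c ≠ 0 ∧ g = MvPolynomial.C c * f

theorem genDisc_sq {k : Type*} [Field k] {ι : Type*} [Fintype ι] [DecidableEq ι]
    (Φ : Fin 2 → Matrix ι ι k) (n : ℕ) (b : Module.Basis (Fin n ⊕ Fin n) k (ι → k))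
    (Ψ : Fin 2 → Matrix (Fin n) (Fin n) k)
    (h : ∀ i, (Matrix.of fun p q => pairBimap Φ (b p) (b q) i) =
      Matrix.fromBlocks 0 (Ψ i) (-(Ψ i)ᵀ) 0) :
    2 * n = Fintype.card ι ∧ ∃ δ : k, δ ≠ 0 ∧ (genDisc Ψ) ^ 2 *
      (Matrix.J (Fin n) (MvPolynomial (Fin 2) k)).det = MvPolynomial.C δ ^ 2 * genDisc Φ := by
  have hcard : 2 * n = Fintype.card ι := by
    have h1 := Module.finrank_eq_card_basis b
    simp at h1
    omega
  refine ⟨hcard, ?_⟩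
  have e : Fin n ⊕ Fin n ≃ ι := Fintype.equivOfCardEq (by simp; omega)
  let P : Matrix (Fin n ⊕ Fin n) ι k := Matrix.of fun p q => b p q
  have hgram : ∀ i, P * Φ i * Pᵀ = Matrix.fromBlocks 0 (Ψ i) (-(Ψ i)ᵀ) 0 := by
    intro i
    rw [← h i]
    ext p q
    rw [Matrix.mul_assoc]
    simp only [Matrix.mul_apply, Matrix.of_apply, pairBimap, dotProduct, Matrix.mulVec,
      Matrix.transpose_apply, P]
  let Q : Matrix ι ι k := P.submatrix e.symm id
  have hQ : Q.det ≠ 0 := by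
    have hli : LinearIndependent k Q.row := by
      have := b.linearIndependent.comp e.symm e.symm.injective
      exact this
    exact (Matrix.isUnit_iff_isUnit_det Q).1 (Matrix.linearIndependent_rows_iff_isUnit.1 hli)
      |>.ne_zero
  refine ⟨Q.det, hQ, ?_⟩
  let R : Type _ := MvPolynomial (Fin 2) k
  let A : Matrix (Fin n) (Fin n) R :=
    ∑ i, (MvPolynomial.X i : R) • (Ψ i).map MvPolynomial.C
  let D : Matrix ι ι R := ∑ i, (MvPolynomial.X i : R) • (Φ i).map MvPolynomial.C
  let PC : Matrix (Fin n ⊕ Fin n) ι R := P.map MvPolynomial.C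
  have h1 : PC * D * PCᵀ = Matrix.fromBlocks 0 A (-Aᵀ) 0 := by
    have h2 : ∀ i, PC * (Φ i).map (MvPolynomial.C : k →+* R) * PCᵀ =
        Matrix.fromBlocks 0 ((Ψ i).map (MvPolynomial.C : k →+* R))
          (-((Ψ i).map (MvPolynomial.C : k →+* R))ᵀ) 0 := by
      intro i
      have := congrArg (fun M => M.map (MvPolynomial.C : k →+* R)) (hgram i)
      simp only [Matrix.map_mul, Matrix.fromBlocks_map] at this
      rw [← Matrix.transpose_map, this]
      congr 1 <;> ext <;> simp
    simp only [D, A, Fin.sum_univ_two, Matrix.mul_add, Matrix.add_mul, Matrix.mul_smul,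
      Matrix.smul_mul, h2, Matrix.fromBlocks_smul, Matrix.fromBlocks_add]
    congr 1 <;> simp [add_comm]
  have h3 : (Matrix.fromBlocks 0 A (-Aᵀ) 0).det * (Matrix.J (Fin n) R).det = A.det ^ 2 := by
    rw [← Matrix.det_mul, Matrix.J, Matrix.fromBlocks_multiply]
    simp [sq]
    left
    rw [neg_neg, Matrix.det_transpose]
  have h4 : (PC * D * PCᵀ).det = MvPolynomial.C Q.det ^ 2 * D.det := by
    have h5 : (PC * D * PCᵀ).submatrix e.symm e.symm =
        (Q.map MvPolynomial.C) * D * (Q.map MvPolynomial.C)ᵀ := rfl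
    rw [← Matrix.det_submatrix_equiv_self e.symm, h5, Matrix.det_mul, Matrix.det_mul,
      Matrix.det_transpose, RingHom.map_det]
    simp only [RingHom.mapMatrix_apply]
    ring
  have hJJ := Matrix.J_det_mul_J_det (Fin n) R
  rw [h1] at h4
  change A.det ^ 2 * (Matrix.J (Fin n) R).det = MvPolynomial.C Q.det ^ 2 * D.det
  rw [← h4, ← h3, mul_assoc, hJJ, mul_one]

/-- The generalized Pfaffian does not depend, up to nonzero scalars, on the choice of the
decomposition and of the bases. -/
theorem IsGenPfaffian.unique {k : Type*} [Field k] {ι : Type*} [Fintype ι]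
    {Φ : Fin 2 → Matrix ι ι k} {f g : MvPolynomial (Fin 2) k}
    (hf : IsGenPfaffian Φ f) (hg : IsGenPfaffian Φ g) : EqModScalars f g := by
  classical
  obtain ⟨n, b, Ψ, h, rfl⟩ := hf
  obtain ⟨m, b', Ψ', h', rfl⟩ := hg
  obtain ⟨hn, δ, hδ, e⟩ := genDisc_sq Φ n b Ψ h
  obtain ⟨hm, δ', hδ', e'⟩ := genDisc_sq Φ m b' Ψ' h'
  obtain rfl : n = m := by omega
  have hJ : (Matrix.J (Fin n) (MvPolynomial (Fin 2) k)).det ≠ 0 :=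
    (Matrix.isUnit_det_J (Fin n) _).ne_zero
  have key : (MvPolynomial.C δ * genDisc Ψ') ^ 2 = (MvPolynomial.C δ' * genDisc Ψ) ^ 2 := by
    apply mul_right_cancel₀ hJ
    linear_combination MvPolynomial.C δ ^ 2 * e' - MvPolynomial.C δ' ^ 2 * e
  have hC : (MvPolynomial.C δ⁻¹ * MvPolynomial.C δ : MvPolynomial (Fin 2) k) = 1 := by
    rw [← map_mul, inv_mul_cancel₀ hδ, map_one]
  rcases sq_eq_sq_iff_eq_or_eq_neg.1 key with h1 | h1
  · refine ⟨δ⁻¹ * δ', mul_ne_zero (inv_ne_zero hδ) hδ', ?_⟩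
    rw [map_mul]
    linear_combination MvPolynomial.C δ⁻¹ * h1 - genDisc Ψ' * hC
  · refine ⟨-(δ⁻¹ * δ'), neg_ne_zero.2 (mul_ne_zero (inv_ne_zero hδ) hδ'), ?_⟩
    rw [map_neg, map_mul]
    linear_combination MvPolynomial.C δ⁻¹ * h1 - genDisc Ψ' * hC

/-- An element `(M, τ)` of `ΓL(2, k) = GL(2, k) ⋊ Gal(k)`, where `Gal(k)` is the group of all
field automorphisms of `k`. -/
structure GammaL2 (k : Type*) [Field k] where
  /-- the matrix `[a, b; c, d]` -/
  mat : GL (Fin 2) k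
  /-- the field automorphism -/
  aut : k ≃+* k

/-- The semilinear action of `ΓL(2, k)` on row vectors: `w ↦ w^τ M`. -/
def GammaL2.act {k : Type*} [Field k] (A : GammaL2 k) (w : Fin 2 → k) : Fin 2 → k :=
  (fun i => A.aut (w i)) ᵥ* (A.mat : Matrix (Fin 2) (Fin 2) k)

/-- The action on polynomials: `f ↦ f^τ(a x + b y, c x + d y)`, where `f^τ` is obtained by applying
`τ` to the coefficients. -/
noncomputable def GammaL2.polyAct {k : Type*} [Field k] (A : GammaL2 k)
    (f : MvPolynomial (Fin 2) k) : MvPolynomial (Fin 2) k :=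
  MvPolynomial.bind₁
    (fun i => MvPolynomial.C ((A.mat : Matrix (Fin 2) (Fin 2) k) i 0) * MvPolynomial.X 0 +
      MvPolynomial.C ((A.mat : Matrix (Fin 2) (Fin 2) k) i 1) * MvPolynomial.X 1)
    (MvPolynomial.map (A.aut : k →+* k) f)

/-- `(α, A)` is a pseudo-isometry from the bimap of `Φ` to the bimap of `Λ` for some bijective
semilinear map `α` (an element of `ΓL(d, k)` when both spaces are `k^d`): one has `(uα) • (vα) = (u ∘ v)A` for all `u`, `v`. -/
def LiftsToPseudoIsometry {k : Type*} [Field k] {ι κ : Type*} [Fintype ι] [Fintype κ]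
    (A : GammaL2 k) (Φ : Fin 2 → Matrix ι ι k) (Λ : Fin 2 → Matrix κ κ k) : Prop :=
  ∃ (ρ : k ≃+* k) (α : (ι → k) →ₛₗ[(ρ : k →+* k)] (κ → k)),
    Function.Bijective α ∧ ∀ u v, pairBimap Λ (α u) (α v) = A.act (pairBimap Φ u v)

/-! Twisting the source pair by `αhat` turns pseudo-isometries over `αhat` into linear isometries of
pairs (`liftsToPseudoIsometry_iff`). Two facts then give the theorem: a decomposition into sloped
indecomposable blocks is unique up to isometry and order, and a block is determined up to isometry
by its Pfaffian.

Structure of a block. After a change of basis of k² the form B₀ is nondegenerate, and B₁(u, v) =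
B₀(u, Tv) defines a self-adjoint operator T. Coprime factors of its minimal polynomial give
orthogonal summands, so that polynomial is a prime power p^(m+1). A cyclic vector and a suitable
dual vector span a copy of `model` on (k[X]/p^(m+1))², which splits off and is therefore everything
(`exists_isometric_model`). The characteristic polynomial of T is p^(2(m+1)) and is a dehomogenized
discriminant up to a scalar; since the discriminant is the square of the Pfaffian up to a scalar,
the Pfaffian determines p and m (`isometric_of_genDisc`).

Uniqueness. Over a small field the whole sum may have no nondegenerate combination, so there need be
no single operator T to which uniqueness for k[X]-modules could be applied. Instead one counts
adjoint pairs (P, Q), that is, B'(Pu, w) = B(u, Qw) for both forms. The dimension of this space is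
additive in orthogonal sums and unchanged by a change of basis of k²; between two blocks it is 2
min(dim V, dim V') if they belong to the same prime and 0 otherwise
(`IsBlock.finrank_adjointPairs`). Only two blocks are compared at a time, and two blocks always
share a nondegenerate combination. As min is a positive definite kernel on distinct positive
integers, the dimensions against all blocks determine the multiset of blocks
(`exists_equiv_of_sum_min`). -/

/-- A pair of bilinear forms on the same space. -/
abbrev FormPair (k V : Type*) [Field k] [AddCommGroup V] [Module k V] :=
  Fin 2 → LinearMap.BilinForm k V

/-! ### Pairs of forms, changes of basis of the target, and spaces of adjoint pairs. -/

namespace FormPair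

variable {k : Type*} [Field k] {V V' V'' : Type*} [AddCommGroup V] [Module k V]
  [AddCommGroup V'] [Module k V'] [AddCommGroup V''] [Module k V'']

/-- Both forms are alternating. -/
def IsAlt (B : FormPair k V) : Prop := ∀ i, (B i).IsAlt

/-- Existence of a linear isomorphism preserving both forms. -/
def Isometric (B : FormPair k V) (B' : FormPair k V') : Prop :=
  ∃ e : V ≃ₗ[k] V', ∀ i u v, B' i (e u) (e v) = B i u v

/-- The space is nonzero and not a nontrivial orthogonal direct sum with respect to both forms. -/
def IsIndec (B : FormPair k V) : Prop :=
  Nontrivial V ∧ ∀ U W : Submodule k V, IsCompl U W →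
    (∀ u ∈ U, ∀ w ∈ W, ∀ i, B i u w = 0) → U = ⊥ ∨ W = ⊥

/-- The pair obtained by a linear change of the target space. -/
def combo (g : Matrix (Fin 2) (Fin 2) k) (B : FormPair k V) : FormPair k V :=
  fun i => ∑ j, g i j • B j

/-- The linear maps `P : V → V'` together with an adjoint `Q : V' → V` for both forms. -/
def adjointPairs (B : FormPair k V) (B' : FormPair k V') :
    Submodule k ((V →ₗ[k] V') × (V' →ₗ[k] V)) where
  carrier := {X | ∀ i u w, B' i (X.1 u) w = B i u (X.2 w)}
  zero_mem' := by intro i u w; simp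
  add_mem' := by intro X Y hX hY i u w; simp [hX i u w, hY i u w]
  smul_mem' := by intro c X hX i u w; simp [hX i u w]

theorem mem_adjointPairs {B : FormPair k V} {B' : FormPair k V'}
    {X : (V →ₗ[k] V') × (V' →ₗ[k] V)} :
    X ∈ adjointPairs B B' ↔ ∀ i u w, B' i (X.1 u) w = B i u (X.2 w) := Iff.rfl

theorem Isometric.refl (B : FormPair k V) : Isometric B B :=
  ⟨LinearEquiv.refl k V, fun _ _ _ => rfl⟩

theorem Isometric.symm {B : FormPair k V} {B' : FormPair k V'} (h : Isometric B B') :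
    Isometric B' B := by
  obtain ⟨e, he⟩ := h
  exact ⟨e.symm, fun i u v => by simpa using (he i (e.symm u) (e.symm v)).symm⟩

theorem Isometric.trans {B : FormPair k V} {B' : FormPair k V'} {B'' : FormPair k V''}
    (h : Isometric B B') (h' : Isometric B' B'') : Isometric B B'' := by
  obtain ⟨e, he⟩ := h
  obtain ⟨e', he'⟩ := h'
  exact ⟨e.trans e', fun i u v => by simp [he, he']⟩

theorem combo_apply (g : Matrix (Fin 2) (Fin 2) k) (B : FormPair k V) (i : Fin 2) (u v : V) :
    combo g B i u v = g i 0 * B 0 u v + g i 1 * B 1 u v := by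
  simp [combo, Fin.sum_univ_two]

theorem combo_combo (g h : Matrix (Fin 2) (Fin 2) k) (B : FormPair k V) :
    combo g (combo h B) = combo (g * h) B := by
  ext i u v
  simp [combo_apply, Matrix.mul_apply, Fin.sum_univ_two]
  ring

theorem combo_one (B : FormPair k V) : combo 1 B = B := by
  funext i
  ext u v
  rw [combo_apply]
  obtain rfl | rfl : i = 0 ∨ i = 1 := by omega
  all_goals simp

theorem combo_inv_combo {g : Matrix (Fin 2) (Fin 2) k} (hg : g.det ≠ 0) (B : FormPair k V) :
    combo g⁻¹ (combo g B) = B := by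
  rw [combo_combo, Matrix.nonsing_inv_mul _ (isUnit_iff_ne_zero.2 hg), combo_one]

theorem Isometric.combo {B : FormPair k V} {B' : FormPair k V'} (h : Isometric B B')
    (g : Matrix (Fin 2) (Fin 2) k) : Isometric (combo g B) (combo g B') := by
  obtain ⟨e, he⟩ := h
  exact ⟨e, fun i u v => by simp [combo_apply, he]⟩

theorem isometric_combo_iff {B : FormPair k V} {B' : FormPair k V'}
    {g : Matrix (Fin 2) (Fin 2) k} (hg : g.det ≠ 0) :
    Isometric (FormPair.combo g B) (FormPair.combo g B') ↔ Isometric B B' := by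
  refine ⟨fun h => ?_, fun h => h.combo g⟩
  simpa only [combo_inv_combo hg] using h.combo g⁻¹

theorem IsAlt.combo {B : FormPair k V} (h : IsAlt B) (g : Matrix (Fin 2) (Fin 2) k) :
    IsAlt (combo g B) := by
  intro i u
  rw [combo_apply, h 0 u, h 1 u]
  simp

theorem IsAlt.swap {B : FormPair k V} (h : IsAlt B) (i : Fin 2) (u v : V) :
    B i u v = - B i v u := by
  rw [(h i).neg_eq]

theorem IsIndec.combo {B : FormPair k V} (h : IsIndec B) {g : Matrix (Fin 2) (Fin 2) k}
    (hg : g.det ≠ 0) : IsIndec (combo g B) := by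
  refine ⟨h.1, fun U W hUW ho => h.2 U W hUW fun u hu w hw i => ?_⟩
  rw [← combo_inv_combo hg B, combo_apply, ho u hu w hw, ho u hu w hw]
  simp

/-- The defining condition is linear in the form. This allows a different basis of k² for each pair
of blocks compared. -/
theorem adjointPairs_combo {g : Matrix (Fin 2) (Fin 2) k} (hg : g.det ≠ 0) (B : FormPair k V)
    (B' : FormPair k V') :
    adjointPairs (combo g B) (combo g B') = adjointPairs B B' := by
  have key : ∀ (g : Matrix (Fin 2) (Fin 2) k) (B : FormPair k V) (B' : FormPair k V'),
      adjointPairs B B' ≤ adjointPairs (FormPair.combo g B) (FormPair.combo g B') := by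
    intro g B B' X hX i u w
    simp [combo_apply, hX 0 u w, hX 1 u w]
  refine le_antisymm ?_ (key g B B')
  simpa only [combo_inv_combo hg] using key g⁻¹ (FormPair.combo g B) (FormPair.combo g B')

/-- Adjoint pairs transported along isometries. -/
theorem nonempty_adjointPairs_congr {W W' : Type*} [AddCommGroup W] [Module k W]
    [AddCommGroup W'] [Module k W'] {B : FormPair k V} {B' : FormPair k V'}
    {C : FormPair k W} {C' : FormPair k W'} (h : Isometric B C) (h' : Isometric B' C') :
    Nonempty (adjointPairs B B' ≃ₗ[k] adjointPairs C C') := by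
  obtain ⟨e, he⟩ := h
  obtain ⟨e', he'⟩ := h'
  refine ⟨LinearEquiv.ofSubmodules ((e.arrowCongr e').prodCongr (e'.arrowCongr e)) _ _ ?_⟩
  ext X
  rw [Submodule.map_equiv_eq_comap_symm, Submodule.mem_comap, mem_adjointPairs, mem_adjointPairs]
  constructor
  · intro H i u w
    have := H i (e.symm u) (e'.symm w)
    rw [← he, ← he'] at this
    simpa using this
  · intro H i u w
    rw [← he, ← he']
    simpa using H i (e u) (e' w)

/-- Interchanging the two components. -/
theorem nonempty_adjointPairs_swap {B : FormPair k V} {B' : FormPair k V'} (h : IsAlt B)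
    (h' : IsAlt B') : Nonempty (adjointPairs B B' ≃ₗ[k] adjointPairs B' B) := by
  refine ⟨LinearEquiv.ofSubmodules (LinearEquiv.prodComm k _ _) _ _ ?_⟩
  ext X
  rw [Submodule.map_equiv_eq_comap_symm, Submodule.mem_comap, mem_adjointPairs, mem_adjointPairs]
  constructor
  · intro H i u w
    have := H i w u
    rw [h'.swap, h.swap] at this
    simpa using this.symm
  · intro H i u w
    have := H i w u
    rw [h.swap, h'.swap] at this
    simpa using this.symm

/-- The orthogonal sum of a family of pairs. -/
def orthSum {J : Type*} [Fintype J] {V : J → Type*} [∀ j, AddCommGroup (V j)]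
    [∀ j, Module k (V j)] (B : ∀ j, FormPair k (V j)) : FormPair k (∀ j, V j) :=
  fun i => ∑ j, (B j i).compl₁₂ (LinearMap.proj j) (LinearMap.proj j)

theorem orthSum_apply {J : Type*} [Fintype J] {V : J → Type*} [∀ j, AddCommGroup (V j)]
    [∀ j, Module k (V j)] (B : ∀ j, FormPair k (V j)) (i : Fin 2) (u v : ∀ j, V j) :
    orthSum B i u v = ∑ j, B j i (u j) (v j) := by
  simp [orthSum]

theorem Isometric.orthSum {J J' : Type*} [Fintype J] [Fintype J'] {V : J → Type*}
    [∀ j, AddCommGroup (V j)] [∀ j, Module k (V j)] {V' : J' → Type*}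
    [∀ j, AddCommGroup (V' j)] [∀ j, Module k (V' j)] {B : ∀ j, FormPair k (V j)}
    {B' : ∀ j, FormPair k (V' j)} (σ : J ≃ J') (h : ∀ j, Isometric (B j) (B' (σ j))) :
    Isometric (orthSum B) (orthSum B') := by
  choose e he using h
  refine ⟨(LinearEquiv.piCongrRight e).trans (LinearEquiv.piCongrLeft k V' σ), fun i u v => ?_⟩
  rw [orthSum_apply, orthSum_apply, ← σ.sum_comp]
  refine Finset.sum_congr rfl fun j _ => ?_
  rw [← he]
  have hσ : ∀ u : ∀ j, V j, (LinearEquiv.piCongrRight e ≪≫ₗ LinearEquiv.piCongrLeft k V' σ) u (σ j)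
      = e j (u j) := fun u =>
    Equiv.piCongrLeft_apply_apply V' σ (fun j => e j (u j)) j
  rw [hσ, hσ]

/-- Adjoint pairs are additive in orthogonal sums. -/
theorem nonempty_adjointPairs_orthSum {J : Type*} [Fintype J] [DecidableEq J] {V : J → Type*}
    [∀ j, AddCommGroup (V j)] [∀ j, Module k (V j)] (B : ∀ j, FormPair k (V j))
    (B' : FormPair k V') :
    Nonempty (adjointPairs (orthSum B) B' ≃ₗ[k] ∀ j, adjointPairs (B j) B') := by
  have hs : ∀ j (i : Fin 2) (u : V j) (w : ∀ j, V j),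
      orthSum B i (LinearMap.single k V j u) w = B j i u (w j) := by
    intro j i u w
    rw [orthSum_apply, Finset.sum_eq_single j]
    · simp
    · intro l _ hl
      simp [hl]
    · simp
  refine ⟨LinearEquiv.ofBijective
    { toFun := fun X j => ⟨(X.1.1 ∘ₗ LinearMap.single k V j, LinearMap.proj j ∘ₗ X.1.2),
        fun i u w => by
          have := X.2 i (LinearMap.single k V j u) w
          rw [hs] at this
          exact this⟩
      map_add' := fun X Y => rfl
      map_smul' := fun c X => rfl } ⟨?_, ?_⟩⟩
  · intro X Y h
    have h1 : ∀ j, _ := fun j => congrArg Subtype.val (congrFun h j)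
    refine Subtype.ext (Prod.ext ?_ ?_)
    · exact LinearMap.pi_ext' fun j => (Prod.ext_iff.1 (h1 j)).1
    · ext w j
      exact LinearMap.congr_fun (Prod.ext_iff.1 (h1 j)).2 w
  · intro Y
    refine ⟨⟨(∑ j, (Y j).1.1 ∘ₗ LinearMap.proj j, LinearMap.pi fun j => (Y j).1.2), ?_⟩, ?_⟩
    · intro i u w
      rw [orthSum_apply]
      simp only [LinearMap.sum_apply, LinearMap.comp_apply, LinearMap.proj_apply, map_sum,
        LinearMap.pi_apply]
      exact Finset.sum_congr rfl fun j _ => (Y j).2 i (u j) w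
    · funext j
      refine Subtype.ext (Prod.ext ?_ ?_)
      · ext u
        change (∑ l, (Y l).1.1 ∘ₗ LinearMap.proj l) (LinearMap.single k V j u) = _
        simp only [LinearMap.sum_apply, LinearMap.comp_apply, LinearMap.proj_apply]
        rw [Finset.sum_eq_single j]
        · simp
        · intro l _ hl
          simp [hl]
        · simp
      · rfl

end FormPair

/-! ### The model pair on the square of k[X]/(μ). -/

namespace FormPair

open Polynomial

variable {k : Type*} [Field k] {V V' : Type*} [AddCommGroup V] [Module k V]
  [AddCommGroup V'] [Module k V']

/-- The coefficient of the largest power of the root in an element of `k[X]/(μ)`. -/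
noncomputable def topCoeff {μ : k[X]} (hμ : μ.Monic) : AdjoinRoot μ →ₗ[k] k :=
  lcoeff k (μ.natDegree - 1) ∘ₗ AdjoinRoot.modByMonicHom hμ

theorem exists_topCoeff_mul_ne_zero {μ : k[X]} (hμ : μ.Monic) {a : AdjoinRoot μ} (ha : a ≠ 0) :
    ∃ b, topCoeff hμ (a * b) ≠ 0 := by
  set q := AdjoinRoot.modByMonicHom hμ a with hq
  have haq : AdjoinRoot.mk μ q = a := AdjoinRoot.mk_leftInverse hμ a
  have hq0 : q ≠ 0 := by
    intro h
    rw [h, map_zero] at haq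
    exact ha haq.symm
  have hμ1 : μ ≠ 1 := by
    rintro rfl
    exact ha (by rw [← haq, AdjoinRoot.mk_eq_zero]; exact one_dvd _)
  have hdeg : q.natDegree < μ.natDegree := by
    obtain ⟨r, rfl⟩ := AdjoinRoot.mk_surjective (g := μ) a
    rw [hq, AdjoinRoot.modByMonicHom_mk]
    exact natDegree_modByMonic_lt r hμ hμ1
  -- This power of X lifts the reduced representative to degree exactly deg μ - 1, so no reduction
  -- occurs and the top coefficient is the leading coefficient of q.
  refine ⟨AdjoinRoot.mk μ (X ^ (μ.natDegree - 1 - q.natDegree)), ?_⟩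
  have hd : (q * X ^ (μ.natDegree - 1 - q.natDegree)).natDegree = μ.natDegree - 1 := by
    rw [natDegree_mul_X_pow _ hq0]
    omega
  rw [← haq, ← map_mul, topCoeff, LinearMap.comp_apply, AdjoinRoot.modByMonicHom_mk,
    (modByMonic_eq_self_iff hμ).2, lcoeff_apply]
  · rw [← congrArg (coeff _) hd, coeff_natDegree]
    simpa using hq0
  · apply degree_lt_degree
    omega

/-- The alternating forms `((a, b), (c, d)) ↦ λ (xⁱ (a d - b c))`, `i = 0, 1`, on the square of
`k[X]/(μ)`, with `x` the class of `X` and `λ` the top coefficient. -/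
noncomputable def model {μ : k[X]} (hμ : μ.Monic) : FormPair k (AdjoinRoot μ × AdjoinRoot μ) :=
  fun i => LinearMap.mk₂ k
    (fun u v => topCoeff hμ (AdjoinRoot.root μ ^ (i : ℕ) * (u.1 * v.2 - u.2 * v.1)))
    (fun u u' v => by rw [← map_add]; congr 1; simp only [Prod.fst_add, Prod.snd_add]; ring)
    (fun c u v => by
      rw [← map_smul]; congr 1; simp only [Prod.smul_fst, Prod.smul_snd, smul_mul_assoc,
        ← smul_sub, mul_smul_comm])
    (fun u v v' => by rw [← map_add]; congr 1; simp only [Prod.fst_add, Prod.snd_add]; ring)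
    (fun c u v => by
      rw [← map_smul]; congr 1; simp only [Prod.smul_fst, Prod.smul_snd,
        ← smul_sub, mul_smul_comm])

theorem model_apply {μ : k[X]} (hμ : μ.Monic) (i : Fin 2) (u v : AdjoinRoot μ × AdjoinRoot μ) :
    model hμ i u v = topCoeff hμ (AdjoinRoot.root μ ^ (i : ℕ) * (u.1 * v.2 - u.2 * v.1)) := rfl

theorem model_zero_apply {μ : k[X]} (hμ : μ.Monic) (u v : AdjoinRoot μ × AdjoinRoot μ) :
    model hμ 0 u v = topCoeff hμ (u.1 * v.2 - u.2 * v.1) := by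
  simp [model_apply]

theorem isAlt_model {μ : k[X]} (hμ : μ.Monic) : IsAlt (model hμ) := by
  intro i u
  rw [model_apply, mul_comm u.2 u.1, sub_self, mul_zero, map_zero]

theorem model_zero_smul {μ : k[X]} (hμ : μ.Monic) (a : AdjoinRoot μ)
    (u v : AdjoinRoot μ × AdjoinRoot μ) : model hμ 0 (a • u) v = model hμ 0 u (a • v) := by
  rw [model_zero_apply, model_zero_apply]
  congr 1
  simp only [Prod.smul_fst, Prod.smul_snd, smul_eq_mul]
  ring

theorem model_one_apply {μ : k[X]} (hμ : μ.Monic) (u v : AdjoinRoot μ × AdjoinRoot μ) :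
    model hμ 1 u v = model hμ 0 (AdjoinRoot.root μ • u) v := by
  rw [model_apply, model_zero_apply]
  congr 1
  simp only [Prod.smul_fst, Prod.smul_snd, smul_eq_mul, Fin.val_one, pow_one]
  ring

theorem separatingLeft_model {μ : k[X]} (hμ : μ.Monic) : (model hμ 0).SeparatingLeft := by
  intro u hu
  by_contra h
  obtain h | h : u.1 ≠ 0 ∨ u.2 ≠ 0 := by
    by_contra! h'
    exact h (Prod.ext h'.1 h'.2)
  · obtain ⟨b, hb⟩ := exists_topCoeff_mul_ne_zero hμ h
    have := hu (0, b)
    rw [model_zero_apply] at this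
    simp at this
    exact hb this
  · obtain ⟨b, hb⟩ := exists_topCoeff_mul_ne_zero hμ h
    have := hu (b, 0)
    rw [model_zero_apply] at this
    simp at this
    exact hb this

theorem finrank_adjoinRoot_prod {μ : k[X]} (hμ : μ.Monic) :
    Module.finrank k (AdjoinRoot μ × AdjoinRoot μ) = 2 * μ.natDegree := by
  have := hμ.finite_adjoinRoot
  rw [Module.finrank_prod, (AdjoinRoot.powerBasis' hμ).finrank, AdjoinRoot.powerBasis'_dim]
  ring

/-- The value `q(T) e` at the class of `q`, for `μ(T) = 0`. -/
noncomputable def cyclicMap {μ : k[X]} (hμ : μ.Monic) (T : Module.End k V) (e : V) :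
    AdjoinRoot μ →ₗ[k] V :=
  LinearMap.applyₗ e ∘ₗ (aeval T).toLinearMap ∘ₗ AdjoinRoot.modByMonicHom hμ

theorem cyclicMap_mk {μ : k[X]} (hμ : μ.Monic) {T : Module.End k V} (hT : aeval T μ = 0) (e : V)
    (q : k[X]) : cyclicMap hμ T e (AdjoinRoot.mk μ q) = aeval T q e := by
  simp [cyclicMap, AdjoinRoot.modByMonicHom_mk, aeval_modByMonic_eq_self_of_root hT]

/-- A nondegenerate form on a finite-dimensional space represents every functional. -/
theorem exists_represent [FiniteDimensional k V] {b : LinearMap.BilinForm k V}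
    (hb : b.SeparatingLeft) (φ : V →ₗ[k] k) : ∃ f, ∀ v, b v f = φ v := by
  have hnd := (LinearMap.BilinForm.Nondegenerate.ofSeparatingLeft hb).flip
  refine ⟨(b.flip.toDual hnd).symm φ, fun v => ?_⟩
  exact LinearMap.BilinForm.apply_toDual_symm_apply (hB := hnd) φ v

/-- Existence of adjoints with respect to a nondegenerate form. -/
theorem exists_adjoint [FiniteDimensional k V] {b : LinearMap.BilinForm k V}
    (hb : b.SeparatingLeft) (c : V →ₗ[k] V' →ₗ[k] k) :
    ∃ Q : V' →ₗ[k] V, ∀ u w, b u (Q w) = c u w := by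
  have hnd := (LinearMap.BilinForm.Nondegenerate.ofSeparatingLeft hb).flip
  refine ⟨(b.flip.toDual hnd).symm.toLinearMap ∘ₗ c.flip, fun u w => ?_⟩
  exact LinearMap.BilinForm.apply_toDual_symm_apply (hB := hnd) (c.flip w) u

theorem eq_zero_of_forall_right {b : LinearMap.BilinForm k V}
    (hb : b.SeparatingLeft) (halt : b.IsAlt) {v : V} (h : ∀ u, b u v = 0) : v = 0 :=
  hb v fun u => by rw [← halt.neg_eq, h, neg_zero]

end FormPair

/-! ### Structure of indecomposable pairs with nondegenerate first form. -/

namespace FormPair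

open Polynomial

variable {k : Type*} [Field k] {V V' : Type*} [AddCommGroup V] [Module k V]
  [AddCommGroup V'] [Module k V']

/-- Both forms are skew, so T is self-adjoint for B₀, and hence so is every polynomial in T. -/
theorem apply_aeval_comm {B : FormPair k V} (hB : IsAlt B) {T : Module.End k V}
    (hT : ∀ u v, B 0 u (T v) = B 1 u v) (q : k[X]) (u v : V) :
    B 0 (aeval T q u) v = B 0 u (aeval T q v) := by
  have h1 : ∀ u v, B 0 (T u) v = B 0 u (T v) := by
    intro u v
    rw [hB.swap, hT, hT, ← hB.swap]
  induction q using Polynomial.induction_on' with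
  | add p q hp hq => simp [hp, hq]
  | monomial n a =>
    simp only [aeval_monomial, Module.algebraMap_end_eq_smul_id, Module.End.mul_apply,
      LinearMap.smul_apply, map_smul, LinearMap.id_apply]
    congr 1
    induction n generalizing u v with
    | zero => simp
    | succ n ih =>
      rw [pow_succ, Module.End.mul_apply, ih, h1, ← Module.End.mul_apply, ← pow_succ', pow_succ]

/-- Moving half of the factors across, T^(2m) gives B₀(T^m u, T^m u) and T^(2m+1) gives B₁(T^m u,
T^m u). Both vanish because both forms are alternating, in characteristic 2 as well. -/
theorem apply_aeval_self {B : FormPair k V} (hB : IsAlt B) {T : Module.End k V}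
    (hT : ∀ u v, B 0 u (T v) = B 1 u v) (q : k[X]) (u : V) : B 0 u (aeval T q u) = 0 := by
  induction q using Polynomial.induction_on' with
  | add p q hp hq => simp [hp, hq]
  | monomial n a =>
    simp only [aeval_monomial, Module.algebraMap_end_eq_smul_id, Module.End.mul_apply,
      LinearMap.smul_apply, map_smul, LinearMap.id_apply]
    have h2 : ∀ m (u v : V), B 0 ((T ^ m) u) v = B 0 u ((T ^ m) v) := by
      intro m u v
      simpa using apply_aeval_comm hB hT (X ^ m) u v
    obtain ⟨m, rfl | rfl⟩ := Nat.even_or_odd' n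
    · rw [two_mul, pow_add, Module.End.mul_apply, ← h2, hB 0, smul_zero]
    · rw [two_mul, pow_succ, pow_add, mul_assoc, Module.End.mul_apply, ← h2, ← pow_succ, pow_succ',
        Module.End.mul_apply, hT, hB 1, smul_zero]

/-- For an indecomposable pair the induced operator has a primary minimal polynomial. -/
theorem exists_aeval_pow_eq_zero [FiniteDimensional k V] {B : FormPair k V} (hB : IsAlt B)
    (hind : IsIndec B) {T : Module.End k V} (hT : ∀ u v, B 0 u (T v) = B 1 u v) :
    ∃ (p : k[X]) (m : ℕ), p.Monic ∧ Irreducible p ∧ aeval T (p ^ (m + 1)) = 0 ∧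
      aeval T (p ^ m) ≠ 0 := by
  classical
  have := hind.1
  have hTint : IsIntegral k T := Algebra.IsIntegral.isIntegral T
  have hμ0 : minpoly k T ≠ 0 := minpoly.ne_zero hTint
  obtain ⟨p, hpm, hp, hpd⟩ := exists_monic_irreducible_factor (minpoly k T) (minpoly.not_isUnit k T)
  obtain ⟨r, hr, hpr⟩ := (FiniteMultiplicity.of_not_isUnit hp.not_isUnit
    hμ0).exists_eq_pow_mul_and_not_dvd
  set n := multiplicity p (minpoly k T) with hn
  have hcop : IsCoprime (p ^ n) r := ((hp.coprime_iff_not_dvd).2 hpr).pow_left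
  have hzero : aeval T (p ^ n * r) = 0 := by rw [← hr, minpoly.aeval]
  have horth : ∀ u ∈ LinearMap.ker (aeval T (p ^ n)), ∀ w ∈ LinearMap.ker (aeval T r),
      ∀ i, B i u w = 0 := by
    have h0 : ∀ u ∈ LinearMap.ker (aeval T (p ^ n)), ∀ w ∈ LinearMap.ker (aeval T r),
        B 0 u w = 0 := by
      intro u hu w hw
      obtain ⟨a, b, hab⟩ := hcop
      -- By the Bézout relation w lies in the image of p^n(T); self-adjointness then moves p^n(T)
      -- onto u, which it kills.
      have hw' : w = aeval T (p ^ n) (aeval T a w) := by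
        rw [← Module.End.mul_apply, ← map_mul]
        have := LinearMap.congr_fun (congrArg (aeval T) hab) w
        rw [map_add, map_mul (aeval T) b r] at this
        simp only [LinearMap.add_apply, Module.End.mul_apply, LinearMap.mem_ker.1 hw, map_zero,
          add_zero, map_one, Module.End.one_apply] at this
        rw [mul_comm, this]
      rw [hw', ← apply_aeval_comm hB hT, LinearMap.mem_ker.1 hu, map_zero, LinearMap.zero_apply]
    intro u hu w hw i
    obtain rfl | rfl : i = 0 ∨ i = 1 := by omega
    · exact h0 u hu w hw
    · rw [← hT]
      refine h0 u hu _ ?_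
      have hc : aeval T r * T = T * aeval T r := by
        simpa using congrArg (aeval T) (mul_comm r X)
      rw [LinearMap.mem_ker, ← Module.End.mul_apply, hc, Module.End.mul_apply,
        LinearMap.mem_ker.1 hw, map_zero]
  have hcompl : IsCompl (LinearMap.ker (aeval T (p ^ n))) (LinearMap.ker (aeval T r)) := by
    refine ⟨disjoint_ker_aeval_of_isCoprime T hcop, codisjoint_iff.2 ?_⟩
    rw [sup_ker_aeval_eq_ker_aeval_mul_of_coprime T hcop, hzero, LinearMap.ker_zero]
  have hpn : aeval T (p ^ n) = 0 := by
    -- If the p-primary part vanished, r would annihilate T, so the minimal polynomial, and with it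
    -- p, would divide r.
    rcases hind.2 _ _ hcompl horth with h | h
    · exfalso
      have hr0 : aeval T r = 0 := by
        refine LinearMap.ext fun v => ?_
        have : aeval T r v ∈ LinearMap.ker (aeval T (p ^ n)) := by
          rw [LinearMap.mem_ker, ← Module.End.mul_apply, ← map_mul, hzero, LinearMap.zero_apply]
        rw [h, Submodule.mem_bot] at this
        simpa using this
      exact hpr (hpd.trans (minpoly.dvd k T hr0))
    · refine LinearMap.ext fun v => ?_
      have : aeval T (p ^ n) v ∈ LinearMap.ker (aeval T r) := by
        rw [LinearMap.mem_ker, ← Module.End.mul_apply, ← map_mul, mul_comm, hzero,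
          LinearMap.zero_apply]
      rw [h, Submodule.mem_bot] at this
      simpa using this
  have hex : ∃ n, aeval T (p ^ n) = 0 := ⟨n, hpn⟩
  have hpos : 0 < Nat.find hex := by
    rw [Nat.find_pos]
    simp
  obtain ⟨j, hj⟩ := Nat.exists_eq_succ_of_ne_zero hpos.ne'
  refine ⟨p, j, hpm, hp, ?_, Nat.find_min hex (by omega)⟩
  have := Nat.find_spec hex
  rwa [hj] at this

/-- Indecomposable pairs of alternating forms with nondegenerate first form are models. -/
theorem exists_isometric_model [FiniteDimensional k V] {B : FormPair k V} (hB : IsAlt B)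
    (hind : IsIndec B) (hnd : (B 0).SeparatingLeft) :
    ∃ (p : k[X]) (m : ℕ) (_ : Irreducible p) (hpm : p.Monic),
      Isometric B (model (hpm.pow (m + 1))) := by
  obtain ⟨T, hT⟩ := exists_adjoint hnd (B 1)
  obtain ⟨p, m, hpm, hp, h0, hne⟩ := exists_aeval_pow_eq_zero hB hind hT
  refine ⟨p, m, hp, hpm, ?_⟩
  set hμ := hpm.pow (m + 1)
  -- The annihilator of e contains p^(m+1) but not p^m, so e generates a copy of k[X]/(p^(m+1)).
  obtain ⟨e, he⟩ : ∃ e, aeval T (p ^ m) e ≠ 0 := by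
    by_contra! h
    exact hne (LinearMap.ext h)
  have hinj : LinearMap.ker (cyclicMap hμ T e) = ⊥ := by
    refine LinearMap.ker_eq_bot'.2 fun a ha => ?_
    obtain ⟨q, rfl⟩ := AdjoinRoot.mk_surjective (g := p ^ (m + 1)) a
    rw [cyclicMap_mk hμ h0] at ha
    rw [AdjoinRoot.mk_eq_zero]
    classical
    obtain ⟨j, hj, hassoc⟩ := (dvd_prime_pow hp.prime (m + 1)).1
      (EuclideanDomain.gcd_dvd_right q (p ^ (m + 1)))
    obtain rfl | hlt := hj.eq_or_lt
    · exact hassoc.symm.dvd.trans (EuclideanDomain.gcd_dvd_left _ _)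
    · exfalso
      obtain ⟨c, hc⟩ : EuclideanDomain.gcd q (p ^ (m + 1)) ∣ p ^ m :=
        hassoc.dvd.trans (pow_dvd_pow p (Nat.lt_succ_iff.1 hlt))
      rw [EuclideanDomain.gcd_eq_gcd_ab] at hc
      apply he
      have hg : p ^ m = EuclideanDomain.gcdA q (p ^ (m + 1)) * c * q +
          EuclideanDomain.gcdB q (p ^ (m + 1)) * c * p ^ (m + 1) := by rw [hc]; ring
      rw [hg, map_add, map_mul (aeval T) _ q, map_mul (aeval T) _ (p ^ (m + 1)), h0]
      simp [ha]
  obtain ⟨ψ, hψ⟩ := LinearMap.exists_leftInverse_of_injective _ hinj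
  -- The vector f is dual to the cyclic space of e: pairing a·e with f returns the top coefficient
  -- of a, exactly as in the model.
  obtain ⟨f, hf⟩ := exists_represent hnd (topCoeff hμ ∘ₗ ψ)
  have hef : ∀ a, B 0 (cyclicMap hμ T e a) f = topCoeff hμ a := fun a => by
    rw [hf, LinearMap.comp_apply, ← LinearMap.comp_apply ψ, hψ, LinearMap.id_apply]
  set Ω : (AdjoinRoot (p ^ (m + 1)) × AdjoinRoot (p ^ (m + 1))) →ₗ[k] V :=
    (cyclicMap hμ T e).coprod (cyclicMap hμ T f) with hΩ
  have hΩB : ∀ u v, B 0 (Ω u) (Ω v) = model hμ 0 u v := by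
    rintro ⟨a, b⟩ ⟨c, d⟩
    obtain ⟨a, rfl⟩ := AdjoinRoot.mk_surjective (g := p ^ (m + 1)) a
    obtain ⟨b, rfl⟩ := AdjoinRoot.mk_surjective (g := p ^ (m + 1)) b
    obtain ⟨c, rfl⟩ := AdjoinRoot.mk_surjective (g := p ^ (m + 1)) c
    obtain ⟨d, rfl⟩ := AdjoinRoot.mk_surjective (g := p ^ (m + 1)) d
    have hef' : ∀ q r : k[X], B 0 (aeval T q e) (aeval T r f) =
        topCoeff hμ (AdjoinRoot.mk _ q * AdjoinRoot.mk _ r) := by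
      intro q r
      rw [← apply_aeval_comm hB hT, ← Module.End.mul_apply, ← map_mul, ← cyclicMap_mk hμ h0, hef,
        mul_comm, map_mul]
    have hself : ∀ (q r : k[X]) (v : V), B 0 (aeval T q v) (aeval T r v) = 0 := by
      intro q r v
      rw [apply_aeval_comm hB hT, ← Module.End.mul_apply, ← map_mul, apply_aeval_self hB hT]
    simp only [hΩ, LinearMap.coprod_apply, cyclicMap_mk hμ h0, map_add, LinearMap.add_apply, hself,
      hef', hB.swap 0 (aeval T b f), model_zero_apply, map_sub]
    rw [mul_comm (AdjoinRoot.mk _ c)]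
    ring
  have hTΩ : ∀ u, T (Ω u) = Ω (AdjoinRoot.root (p ^ (m + 1)) • u) := by
    rintro ⟨a, b⟩
    obtain ⟨a, rfl⟩ := AdjoinRoot.mk_surjective (g := p ^ (m + 1)) a
    obtain ⟨b, rfl⟩ := AdjoinRoot.mk_surjective (g := p ^ (m + 1)) b
    simp only [hΩ, LinearMap.coprod_apply, Prod.smul_mk, smul_eq_mul, ← AdjoinRoot.mk_X, ← map_mul,
      cyclicMap_mk hμ h0, map_add]
    simp
  have hΩinj : Function.Injective Ω := by
    rw [injective_iff_map_eq_zero]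
    intro u hu
    refine separatingLeft_model hμ u fun v => ?_
    rw [← hΩB, hu, map_zero, LinearMap.zero_apply]
  -- The range of Ω is nondegenerate for B₀ and T-invariant, so its B₀-orthogonal complement is a
  -- complement orthogonal for both forms.
  have hres : ((B 0).restrict (LinearMap.range Ω)).Nondegenerate := by
    apply LinearMap.BilinForm.Nondegenerate.ofSeparatingLeft
    rintro ⟨_, u, rfl⟩ hu
    have : u = 0 := separatingLeft_model hμ u fun v => by
      rw [← hΩB]
      exact hu ⟨Ω v, v, rfl⟩
    simp [this]
  have hcompl := LinearMap.BilinForm.isCompl_orthogonal_of_restrict_nondegenerate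
    (hB 0).isRefl hres
  have horth : ∀ u ∈ LinearMap.range Ω, ∀ w ∈ (B 0).orthogonal (LinearMap.range Ω),
      ∀ i, B i u w = 0 := by
    rintro _ ⟨u, rfl⟩ w hw i
    obtain rfl | rfl : i = 0 ∨ i = 1 := by omega
    · exact hw _ ⟨u, rfl⟩
    · rw [hB.swap, ← hT, hTΩ, ← hB.swap]
      exact hw _ ⟨_, rfl⟩
  have hΩsurj : Function.Surjective Ω := by
    rw [← LinearMap.range_eq_top]
    rcases hind.2 _ _ hcompl horth with h | h
    · exfalso
      apply he
      rw [← cyclicMap_mk hμ h0]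
      have : Ω (AdjoinRoot.mk _ (p ^ m), 0) ∈ LinearMap.range Ω := ⟨_, rfl⟩
      rw [h, Submodule.mem_bot] at this
      simpa [hΩ] using this
    · simpa [h] using hcompl.sup_eq_top
  refine Isometric.symm ⟨LinearEquiv.ofBijective Ω ⟨hΩinj, hΩsurj⟩, fun i u v => ?_⟩
  change B i (Ω u) (Ω v) = _
  obtain rfl | rfl : i = 0 ∨ i = 1 := by omega
  · exact hΩB u v
  · rw [← hT, hTΩ, hΩB, model_one_apply, model_zero_smul]

end FormPair

/-! ### Adjoint pairs between blocks of a given prime. -/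

namespace FormPair

open Polynomial

variable {k : Type*} [Field k] {V V' V'' : Type*} [AddCommGroup V] [Module k V]
  [AddCommGroup V'] [Module k V'] [AddCommGroup V''] [Module k V'']

/-- Adjointness for both forms makes P commute with the two operators, by nondegeneracy of the
target, so P is k[X]-linear. -/
theorem adjointPairs_model_mk_smul {μ μ' : k[X]} {hμ : μ.Monic} {hμ' : μ'.Monic}
    {X : (AdjoinRoot μ × AdjoinRoot μ →ₗ[k] AdjoinRoot μ' × AdjoinRoot μ') ×
      (AdjoinRoot μ' × AdjoinRoot μ' →ₗ[k] AdjoinRoot μ × AdjoinRoot μ)}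
    (hX : X ∈ adjointPairs (model hμ) (model hμ')) (q : k[X]) (u : AdjoinRoot μ × AdjoinRoot μ) :
    X.1 (AdjoinRoot.mk μ q • u) = AdjoinRoot.mk μ' q • X.1 u := by
  have hroot : ∀ u, X.1 (AdjoinRoot.root μ • u) = AdjoinRoot.root μ' • X.1 u := by
    intro u
    rw [← sub_eq_zero]
    refine separatingLeft_model hμ' _ fun w => ?_
    rw [map_sub, LinearMap.sub_apply, hX, ← model_one_apply, ← model_one_apply, hX, sub_self]
  induction q using Polynomial.induction_on generalizing u with
  | C a =>
    rw [AdjoinRoot.mk_C, AdjoinRoot.mk_C, ← AdjoinRoot.algebraMap_eq, ← AdjoinRoot.algebraMap_eq,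
      algebraMap_smul, algebraMap_smul, map_smul]
  | add p q hp hq => rw [map_add, map_add, add_smul, add_smul, map_add, hp, hq]
  | monomial n a ih =>
    rw [pow_succ, ← mul_assoc, map_mul, map_mul (AdjoinRoot.mk μ'), mul_smul, mul_smul, ih,
      AdjoinRoot.mk_X, AdjoinRoot.mk_X, hroot]

theorem adjointPairs_model_eq_zero {μ μ' : k[X]} {hμ : μ.Monic} {hμ' : μ'.Monic}
    {X : (AdjoinRoot μ × AdjoinRoot μ →ₗ[k] AdjoinRoot μ' × AdjoinRoot μ') ×
      (AdjoinRoot μ' × AdjoinRoot μ' →ₗ[k] AdjoinRoot μ × AdjoinRoot μ)}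
    (hX : X ∈ adjointPairs (model hμ) (model hμ')) (h : X.1 = 0) : X = 0 := by
  refine Prod.ext h (LinearMap.ext fun w => ?_)
  refine eq_zero_of_forall_right (separatingLeft_model hμ) (isAlt_model hμ 0) fun u => ?_
  rw [← hX, h, LinearMap.zero_apply, map_zero, LinearMap.zero_apply]

theorem adjointPairs_model_of_isCoprime {μ μ' : k[X]} (hμ : μ.Monic) (hμ' : μ'.Monic)
    (hc : IsCoprime μ μ') : adjointPairs (model hμ) (model hμ') = ⊥ := by
  refine (Submodule.eq_bot_iff _).2 fun X hX => adjointPairs_model_eq_zero hX ?_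
  obtain ⟨a, b, hab⟩ := hc
  refine LinearMap.ext fun u => ?_
  have h1 : AdjoinRoot.mk μ' (a * μ) = 1 := by
    rw [← map_one (AdjoinRoot.mk μ'), ← hab, map_add, map_mul _ b, AdjoinRoot.mk_self, mul_zero,
      add_zero]
  rw [← one_smul (AdjoinRoot μ') (X.1 u), ← h1, ← adjointPairs_model_mk_smul hX, map_mul,
    AdjoinRoot.mk_self, mul_zero, zero_smul, map_zero, LinearMap.zero_apply]

/-- P is a k[X]-linear map on a module free of rank 2 over k[X]/(μ). Since μ' divides μ, the images
of the two generators are arbitrary, and Q is the adjoint of P. -/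
theorem finrank_adjointPairs_model_of_dvd {μ μ' : k[X]} (hμ : μ.Monic) (hμ' : μ'.Monic)
    (hd : μ' ∣ μ) :
    Module.finrank k (adjointPairs (model hμ) (model hμ')) = 2 * (2 * μ'.natDegree) := by
  have := hμ.finite_adjoinRoot
  have := hμ'.finite_adjoinRoot
  let W := AdjoinRoot μ' × AdjoinRoot μ'
  let ev : adjointPairs (model hμ) (model hμ') →ₗ[k] W × W :=
    { toFun := fun X => (X.1.1 (1, 0), X.1.1 (0, 1))
      map_add' := fun X Y => rfl
      map_smul' := fun c X => rfl }
  have hinj : Function.Injective ev := by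
    rw [injective_iff_map_eq_zero]
    rintro ⟨X, hX⟩ h
    obtain ⟨h1, h2⟩ : X.1 (1, 0) = 0 ∧ X.1 (0, 1) = 0 := Prod.ext_iff.1 h
    refine Subtype.ext (adjointPairs_model_eq_zero hX (LinearMap.ext fun u => ?_))
    obtain ⟨a, b⟩ := u
    obtain ⟨a, rfl⟩ := AdjoinRoot.mk_surjective (g := μ) a
    obtain ⟨b, rfl⟩ := AdjoinRoot.mk_surjective (g := μ) b
    have : (AdjoinRoot.mk μ a, AdjoinRoot.mk μ b) =
        AdjoinRoot.mk μ a • ((1, 0) : AdjoinRoot μ × AdjoinRoot μ) +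
          AdjoinRoot.mk μ b • ((0, 1) : AdjoinRoot μ × AdjoinRoot μ) := by simp
    rw [this, map_add, adjointPairs_model_mk_smul hX, adjointPairs_model_mk_smul hX, h1, h2,
      smul_zero, smul_zero, add_zero, LinearMap.zero_apply]
  have hsurj : Function.Surjective ev := by
    rintro ⟨v, w⟩
    let π := AdjoinRoot.algHomOfDvd k μ μ' hd
    let P : AdjoinRoot μ × AdjoinRoot μ →ₗ[k] W :=
      (π.toLinearMap.smulRight v).coprod (π.toLinearMap.smulRight w)
    have hP : ∀ u, P u = π u.1 • v + π u.2 • w := fun u => rfl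
    have hπ : π (AdjoinRoot.root μ) = AdjoinRoot.root μ' := AdjoinRoot.algHomOfDvd_root μ μ' hd
    have hPr : ∀ u, P (AdjoinRoot.root μ • u) = AdjoinRoot.root μ' • P u := by
      intro u
      rw [hP, hP, smul_add, Prod.smul_fst, Prod.smul_snd, smul_eq_mul, smul_eq_mul, map_mul,
        map_mul, hπ, mul_smul, mul_smul]
    obtain ⟨Q, hQ⟩ := exists_adjoint (separatingLeft_model hμ) (model hμ' 0 ∘ₗ P)
    refine ⟨⟨(P, Q), fun i u w => ?_⟩, ?_⟩
    · obtain rfl | rfl : i = 0 ∨ i = 1 := by omega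
      · exact (hQ u w).symm
      · rw [model_one_apply, model_one_apply, hQ, LinearMap.comp_apply, hPr]
    · refine Prod.ext ?_ ?_
      · change P (1, 0) = v
        simp [hP]
      · change P (0, 1) = w
        simp [hP]
  rw [(LinearEquiv.ofBijective ev ⟨hinj, hsurj⟩).finrank_eq, Module.finrank_prod,
    finrank_adjoinRoot_prod hμ']
  ring

/-- The pair is isometric to the model of a power of the monic irreducible polynomial `p`. -/
def HasType (B : FormPair k V) (p : k[X]) : Prop :=
  ∃ (m : ℕ) (hpm : p.Monic), Irreducible p ∧ Isometric B (model (hpm.pow (m + 1)))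

theorem finrank_adjointPairs_of_hasType [FiniteDimensional k V] [FiniteDimensional k V']
    {B : FormPair k V} {B' : FormPair k V'} {p q : k[X]} [Decidable (p = q)]
    (h : HasType B p) (h' : HasType B' q) :
    Module.finrank k (adjointPairs B B') =
      if p = q then 2 * min (Module.finrank k V) (Module.finrank k V') else 0 := by
  obtain ⟨m, hpm, hp, hB⟩ := h
  obtain ⟨l, hqm, hq, hB'⟩ := h'
  obtain ⟨E⟩ := nonempty_adjointPairs_congr hB hB'
  have hV : Module.finrank k V = 2 * (p ^ (m + 1)).natDegree := by
    rw [← finrank_adjoinRoot_prod (hpm.pow (m + 1))]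
    exact hB.choose.finrank_eq
  have hV' : Module.finrank k V' = 2 * (q ^ (l + 1)).natDegree := by
    rw [← finrank_adjoinRoot_prod (hqm.pow (l + 1))]
    exact hB'.choose.finrank_eq
  rw [E.finrank_eq, hV, hV']
  split_ifs with hpq
  · subst hpq
    rcases le_total l m with hl | hl
    · have hd := pow_dvd_pow p (Nat.succ_le_succ hl)
      rw [finrank_adjointPairs_model_of_dvd _ _ hd, min_eq_right]
      exact Nat.mul_le_mul_left 2 (natDegree_le_of_dvd hd (hpm.pow (m + 1)).ne_zero)
    · have hd := pow_dvd_pow p (Nat.succ_le_succ hl)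
      obtain ⟨E'⟩ := nonempty_adjointPairs_swap (isAlt_model (hpm.pow (m + 1)))
        (isAlt_model (hqm.pow (l + 1)))
      rw [E'.finrank_eq, finrank_adjointPairs_model_of_dvd _ _ hd, min_eq_left]
      exact Nat.mul_le_mul_left 2 (natDegree_le_of_dvd hd (hqm.pow (l + 1)).ne_zero)
  · rw [adjointPairs_model_of_isCoprime, finrank_bot]
    refine IsCoprime.pow ((hp.coprime_iff_not_dvd).2 fun hd => hpq ?_)
    exact eq_of_monic_of_associated hpm hqm (hp.associated_of_dvd hq hd)

theorem isometric_of_hasType [FiniteDimensional k V] [FiniteDimensional k V']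
    {B : FormPair k V} {B' : FormPair k V'} {p : k[X]} (h : HasType B p) (h' : HasType B' p)
    (hdim : Module.finrank k V = Module.finrank k V') : Isometric B B' := by
  obtain ⟨m, hpm, hp, hB⟩ := h
  obtain ⟨l, hqm, hq, hB'⟩ := h'
  have hV : Module.finrank k V = 2 * (p ^ (m + 1)).natDegree := by
    rw [← finrank_adjoinRoot_prod (hpm.pow (m + 1))]
    exact hB.choose.finrank_eq
  have hV' : Module.finrank k V' = 2 * (p ^ (l + 1)).natDegree := by
    rw [← finrank_adjoinRoot_prod (hqm.pow (l + 1))]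
    exact hB'.choose.finrank_eq
  have hml : m = l := by
    rw [hV, hV', natDegree_pow, natDegree_pow] at hdim
    have := hp.natDegree_pos
    have := Nat.eq_of_mul_eq_mul_right this (Nat.eq_of_mul_eq_mul_left two_pos hdim)
    omega
  subst hml
  exact hB.trans hB'.symm

/-! ### Nondegenerate combinations and the linking relation between blocks. -/

/-- The linear combination of the two forms with coefficients `c`, `d` is nondegenerate. -/
def IsSlope (B : FormPair k V) (c d : k) : Prop := (c • B 0 + d • B 1).SeparatingLeft

theorem isSlope_combo_iff {g : Matrix (Fin 2) (Fin 2) k} {B : FormPair k V} {c d : k} :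
    IsSlope (combo g B) c d ↔
      IsSlope B (c * g 0 0 + d * g 1 0) (c * g 0 1 + d * g 1 1) := by
  have : c • combo g B 0 + d • combo g B 1 =
      (c * g 0 0 + d * g 1 0) • B 0 + (c * g 0 1 + d * g 1 1) • B 1 := by
    ext u v
    simp only [LinearMap.add_apply, LinearMap.smul_apply, combo_apply, smul_eq_mul]
    ring
  rw [IsSlope, IsSlope, this]

theorem isSlope_iff_combo {g : Matrix (Fin 2) (Fin 2) k} (hg : g.det ≠ 0) {B : FormPair k V}
    {c d : k} : IsSlope B c d ↔
      IsSlope (combo g B) (c * g⁻¹ 0 0 + d * g⁻¹ 1 0) (c * g⁻¹ 0 1 + d * g⁻¹ 1 1) := by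
  rw [← isSlope_combo_iff, combo_inv_combo hg]

theorem Isometric.isSlope {B : FormPair k V} {B' : FormPair k V'} (h : Isometric B B') {c d : k}
    (hB : IsSlope B c d) : IsSlope B' c d := by
  obtain ⟨e, he⟩ := h
  intro u hu
  rw [← e.symm.map_eq_zero_iff]
  refine hB _ fun v => ?_
  have h0 := he 0 (e.symm u) v
  have h1 := he 1 (e.symm u) v
  rw [e.apply_symm_apply] at h0 h1
  simpa [← h0, ← h1] using hu (e v)

/-- The combination is the first model form composed with multiplication by c + dX, which is
invertible modulo p^(m+1) exactly when p does not divide it. -/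
theorem isSlope_iff_of_hasType {B : FormPair k V} {p : k[X]} (h : HasType B p) (c d : k) :
    IsSlope B c d ↔ ¬ p ∣ C c + C d * X := by
  obtain ⟨m, hpm, hp, hB⟩ := h
  set hμ := hpm.pow (m + 1)
  have hval : ∀ u v, (c • model hμ 0 + d • model hμ 1) u v =
      model hμ 0 (AdjoinRoot.mk (p ^ (m + 1)) (C c + C d * X) • u) v := by
    intro u v
    rw [map_add, map_mul, AdjoinRoot.mk_C, AdjoinRoot.mk_C, AdjoinRoot.mk_X, add_smul, mul_smul,
      ← AdjoinRoot.algebraMap_eq, algebraMap_smul, algebraMap_smul, map_add, map_smul, map_smul]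
    simp only [LinearMap.add_apply, LinearMap.smul_apply, model_one_apply]
  constructor
  · rintro hs ⟨r, hr⟩
    have h0 : ((AdjoinRoot.mk (p ^ (m + 1)) (p ^ m), 0) :
        AdjoinRoot (p ^ (m + 1)) × AdjoinRoot (p ^ (m + 1))) = 0 := by
      refine hB.isSlope hs _ fun v => ?_
      rw [hval, Prod.smul_mk, smul_zero, smul_eq_mul, ← map_mul, hr,
        show p * r * p ^ m = r * p ^ (m + 1) by ring, map_mul, AdjoinRoot.mk_self, mul_zero,
        Prod.mk_zero_zero, map_zero, LinearMap.zero_apply]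
    have h1 := (Prod.ext_iff.1 h0).1
    rw [Prod.fst_zero, AdjoinRoot.mk_eq_zero, pow_dvd_pow_iff hp.ne_zero hp.not_isUnit] at h1
    omega
  · intro hnd
    apply hB.symm.isSlope
    intro u hu
    have h1 : AdjoinRoot.mk (p ^ (m + 1)) (C c + C d * X) • u = 0 :=
      separatingLeft_model hμ _ fun v => by rw [← hval, hu]
    obtain ⟨a, b, hab⟩ : IsCoprime (p ^ (m + 1)) (C c + C d * X) :=
      ((hp.coprime_iff_not_dvd).2 hnd).pow_left
    have h2 := congrArg (AdjoinRoot.mk (p ^ (m + 1))) hab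
    rw [map_add, map_mul, AdjoinRoot.mk_self, mul_zero, zero_add, map_one, map_mul] at h2
    rw [← one_smul (AdjoinRoot (p ^ (m + 1))) u, ← h2, mul_smul, h1, smul_zero]

/-- Indecomposable sloped pairs of alternating forms. -/
structure IsBlock (B : FormPair k V) : Prop where
  isAlt : IsAlt B
  isIndec : IsIndec B
  sloped : ∃ c d, IsSlope B c d

theorem exists_matrix_row {c d : k} (h : c ≠ 0 ∨ d ≠ 0) :
    ∃ g : Matrix (Fin 2) (Fin 2) k, g.det ≠ 0 ∧ g 0 0 = c ∧ g 0 1 = d := by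
  by_cases hc : c = 0
  · refine ⟨!![c, d; 1, 0], ?_, rfl, rfl⟩
    simpa [Matrix.det_fin_two, hc] using h
  · refine ⟨!![c, d; 0, 1], ?_, rfl, rfl⟩
    simpa [Matrix.det_fin_two] using hc

theorem IsBlock.ne_zero_of_isSlope {B : FormPair k V} (h : IsBlock B) {c d : k}
    (hs : IsSlope B c d) : c ≠ 0 ∨ d ≠ 0 := by
  by_contra! h0
  have := h.isIndec.1
  obtain ⟨u, hu⟩ := exists_ne (0 : V)
  exact hu (hs u fun v => by simp [h0])

theorem IsBlock.exists_hasType_combo [FiniteDimensional k V] {B : FormPair k V} (h : IsBlock B)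
    {g : Matrix (Fin 2) (Fin 2) k} (hg : g.det ≠ 0) (hs : IsSlope B (g 0 0) (g 0 1)) :
    ∃ p, HasType (combo g B) p := by
  obtain ⟨p, m, hp, hpm, hiso⟩ := exists_isometric_model (h.isAlt.combo g) (h.isIndec.combo hg)
    (by simpa [combo, Fin.sum_univ_two, IsSlope] using hs)
  exact ⟨p, m, hpm, hp, hiso⟩

/-- An indecomposable sloped pair has at most one degenerate combination, up to scalars. -/
theorem IsBlock.isSlope_or_isSlope [FiniteDimensional k V] {B : FormPair k V} (h : IsBlock B)
    {c d c' d' : k} (hne : c * d' - d * c' ≠ 0) : IsSlope B c d ∨ IsSlope B c' d' := by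
  obtain ⟨a, b, hab⟩ := h.sloped
  obtain ⟨g, hg, rfl, rfl⟩ := exists_matrix_row (h.ne_zero_of_isSlope hab)
  obtain ⟨p, hp⟩ := h.exists_hasType_combo hg hab
  by_contra! hcon
  rw [isSlope_iff_combo hg (c := c), isSlope_iff_combo hg (c := c'), isSlope_iff_of_hasType hp,
    isSlope_iff_of_hasType hp, not_not, not_not] at hcon
  obtain ⟨h1, h2⟩ := hcon
  -- Eliminating X from the two linear polynomials divisible by p leaves a constant, the product of
  -- two nonzero determinants.
  have h3 := dvd_sub (h1.mul_left (C (c' * g⁻¹ 0 1 + d' * g⁻¹ 1 1)))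
    (h2.mul_left (C (c * g⁻¹ 0 1 + d * g⁻¹ 1 1)))
  have h4 : C (c' * g⁻¹ 0 1 + d' * g⁻¹ 1 1) * (C (c * g⁻¹ 0 0 + d * g⁻¹ 1 0) +
      C (c * g⁻¹ 0 1 + d * g⁻¹ 1 1) * X) - C (c * g⁻¹ 0 1 + d * g⁻¹ 1 1) *
      (C (c' * g⁻¹ 0 0 + d' * g⁻¹ 1 0) + C (c' * g⁻¹ 0 1 + d' * g⁻¹ 1 1) * X) =
      C ((c * d' - d * c') * g⁻¹.det) := by
    rw [Matrix.det_fin_two]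
    simp only [map_add, map_mul, map_sub]
    ring
  rw [h4] at h3
  have h5 : (c * d' - d * c') * g⁻¹.det ≠ 0 := by
    refine mul_ne_zero hne ?_
    rw [Matrix.det_nonsing_inv, Ring.inverse_eq_inv']
    exact inv_ne_zero hg
  obtain ⟨m, hpm, hirr, -⟩ := hp
  exact hirr.not_isUnit (isUnit_of_dvd_unit h3 (isUnit_C.2 (isUnit_iff_ne_zero.2 h5)))

/-- Two indecomposable sloped pairs have a common nondegenerate combination. -/
theorem IsBlock.exists_common_isSlope [FiniteDimensional k V] [FiniteDimensional k V']
    {B : FormPair k V} {B' : FormPair k V'} (h : IsBlock B) (h' : IsBlock B') :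
    ∃ c d, IsSlope B c d ∧ IsSlope B' c d := by
  by_contra! hcon
  -- The projective line over any field has the three distinct points (1:0), (0:1), (1:1), and each
  -- block excludes at most one of them.
  have h1 := h.isSlope_or_isSlope (c := 1) (d := 0) (c' := 0) (d' := 1) (by simp)
  have h2 := h.isSlope_or_isSlope (c := 1) (d := 0) (c' := 1) (d' := 1) (by simp)
  have h3 := h.isSlope_or_isSlope (c := 0) (d := 1) (c' := 1) (d' := 1) (by simp)
  have h4 := h'.isSlope_or_isSlope (c := 1) (d := 0) (c' := 0) (d' := 1) (by simp)
  have h5 := h'.isSlope_or_isSlope (c := 1) (d := 0) (c' := 1) (d' := 1) (by simp)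
  have h6 := h'.isSlope_or_isSlope (c := 0) (d := 1) (c' := 1) (d' := 1) (by simp)
  by_cases e1 : IsSlope B 1 0
  · have f1 := hcon 1 0 e1
    by_cases e2 : IsSlope B 0 1
    · exact (h4.resolve_left f1 |> hcon 0 1 e2)
    · exact (h5.resolve_left f1 |> hcon 1 1 (h3.resolve_left e2))
  · have e2 := h1.resolve_left e1
    exact h6.elim (hcon 0 1 e2) (hcon 1 1 (h2.resolve_left e1))

theorem IsBlock.exists_common_hasType [FiniteDimensional k V] [FiniteDimensional k V']
    {B : FormPair k V} {B' : FormPair k V'} (h : IsBlock B) (h' : IsBlock B') :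
    ∃ g : Matrix (Fin 2) (Fin 2) k, g.det ≠ 0 ∧
      ∃ p q, HasType (combo g B) p ∧ HasType (combo g B') q := by
  obtain ⟨c, d, hs, hs'⟩ := h.exists_common_isSlope h'
  obtain ⟨g, hg, rfl, rfl⟩ := exists_matrix_row (h.ne_zero_of_isSlope hs)
  obtain ⟨p, hp⟩ := h.exists_hasType_combo hg hs
  obtain ⟨q, hq⟩ := h'.exists_hasType_combo hg hs'
  exact ⟨g, hg, p, q, hp, hq⟩

/-- Two pairs are linked if there are nonzero adjoint pairs of maps between them. -/
def Linked (B : FormPair k V) (B' : FormPair k V') : Prop :=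
  Module.finrank k (adjointPairs B B') ≠ 0

/-- This identifies linking with equality of primes for any admissible g, whereas the definition of
linking involves no choice of g. -/
theorem linked_iff [FiniteDimensional k V] [FiniteDimensional k V'] [Nontrivial V] [Nontrivial V']
    {B : FormPair k V} {B' : FormPair k V'} {g : Matrix (Fin 2) (Fin 2) k} (hg : g.det ≠ 0)
    {p q : k[X]} (h : HasType (combo g B) p) (h' : HasType (combo g B') q) :
    Linked B B' ↔ p = q := by
  classical
  rw [Linked, ← adjointPairs_combo hg, finrank_adjointPairs_of_hasType h h']
  have h1 : 0 < Module.finrank k V := Module.finrank_pos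
  have h2 : 0 < Module.finrank k V' := Module.finrank_pos
  split_ifs with hpq
  · simp only [hpq, ne_eq, iff_true]
    omega
  · simp [hpq]

theorem IsBlock.finrank_adjointPairs [FiniteDimensional k V] [FiniteDimensional k V']
    {B : FormPair k V} {B' : FormPair k V'} [Decidable (Linked B B')] (h : IsBlock B)
    (h' : IsBlock B') : Module.finrank k (adjointPairs B B') =
      if Linked B B' then 2 * min (Module.finrank k V) (Module.finrank k V') else 0 := by
  classical
  split_ifs with hl
  · have := h.isIndec.1
    have := h'.isIndec.1
    obtain ⟨g, hg, p, q, hp, hq⟩ := h.exists_common_hasType h'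
    rw [← adjointPairs_combo hg, finrank_adjointPairs_of_hasType hp hq,
      if_pos ((linked_iff hg hp hq).1 hl)]
  · exact not_not.1 hl

theorem IsBlock.linked_refl [FiniteDimensional k V] {B : FormPair k V} (h : IsBlock B) :
    Linked B B := by
  have := h.isIndec.1
  obtain ⟨g, hg, p, -, hp, -⟩ := h.exists_common_hasType h
  exact (linked_iff hg hp hp).2 rfl

theorem IsBlock.linked_symm {B : FormPair k V} {B' : FormPair k V'} (h : IsBlock B)
    (h' : IsBlock B') (hl : Linked B B') : Linked B' B := by
  obtain ⟨E⟩ := nonempty_adjointPairs_swap h'.isAlt h.isAlt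
  rw [Linked, E.finrank_eq]
  exact hl

theorem IsBlock.isSlope_of_linked [FiniteDimensional k V] [FiniteDimensional k V']
    {B : FormPair k V} {B' : FormPair k V'} (h : IsBlock B) (h' : IsBlock B') (hl : Linked B B')
    {c d : k} (hs : IsSlope B c d) : IsSlope B' c d := by
  have := h.isIndec.1
  have := h'.isIndec.1
  obtain ⟨g, hg, p, q, hp, hq⟩ := h.exists_common_hasType h'
  obtain rfl := (linked_iff hg hp hq).1 hl
  rwa [isSlope_iff_combo hg, isSlope_iff_of_hasType hq, ← isSlope_iff_of_hasType hp,
    ← isSlope_iff_combo hg]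

/-- Over the field with two elements three arbitrary blocks may have no common nondegenerate
combination, but linked blocks have the same ones. A slope of the first therefore serves all three.
-/
theorem IsBlock.linked_trans [FiniteDimensional k V] [FiniteDimensional k V']
    [FiniteDimensional k V''] {B : FormPair k V} {B' : FormPair k V'} {B'' : FormPair k V''}
    (h : IsBlock B) (h' : IsBlock B') (h'' : IsBlock B'') (hl : Linked B B')
    (hl' : Linked B' B'') : Linked B B'' := by
  have := h.isIndec.1
  have := h'.isIndec.1
  have := h''.isIndec.1
  obtain ⟨c, d, hs⟩ := h.sloped
  have hs' := h.isSlope_of_linked h' hl hs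
  have hs'' := h'.isSlope_of_linked h'' hl' hs'
  obtain ⟨g, hg, rfl, rfl⟩ := exists_matrix_row (h.ne_zero_of_isSlope hs)
  obtain ⟨p, hp⟩ := h.exists_hasType_combo hg hs
  obtain ⟨p', hp'⟩ := h'.exists_hasType_combo hg hs'
  obtain ⟨p'', hp''⟩ := h''.exists_hasType_combo hg hs''
  rw [linked_iff hg hp hp'] at hl
  rw [linked_iff hg hp' hp''] at hl'
  rw [linked_iff hg hp hp'', hl, hl']

theorem IsBlock.isometric_of_linked [FiniteDimensional k V] [FiniteDimensional k V']
    {B : FormPair k V} {B' : FormPair k V'} (h : IsBlock B) (h' : IsBlock B') (hl : Linked B B')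
    (hdim : Module.finrank k V = Module.finrank k V') : Isometric B B' := by
  have := h.isIndec.1
  have := h'.isIndec.1
  obtain ⟨g, hg, p, q, hp, hq⟩ := h.exists_common_hasType h'
  obtain rfl := (linked_iff hg hp hq).1 hl
  exact (isometric_combo_iff hg).1 (isometric_of_hasType hp hq hdim)

end FormPair

/-! ### Combinatorics: the min kernel determines a multiset. -/

/-- A weighted family is balanced in every class as soon as all its pairings with respect to the
kernel `(x, y) ↦ min (n x) (n y)` (on equal classes) vanish. -/
theorem sum_ite_eq_zero_of_sum_min {K Q : Type*} [Fintype K] [Fintype Q] [DecidableEq Q]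
    (f : K → Q) (n : K → ℕ) (c : K → ℤ)
    (h : ∀ x, ∑ y, c y * (if f x = f y then (min (n x) (n y) : ℕ) else 0 : ℕ) = 0) (q : Q) (l : ℕ) :
    ∑ x, (if f x = q ∧ l < n x then c x else 0) = 0 := by
  obtain ⟨N, hN⟩ : ∃ N, ∀ x, n x < N := by
    refine ⟨∑ x, n x + 1, fun x => Nat.lt_succ_of_le ?_⟩
    exact Finset.single_le_sum (f := n) (fun _ _ => Nat.zero_le _) (Finset.mem_univ x)
  by_cases hl : l < N
  swap
  · refine Finset.sum_eq_zero fun x _ => if_neg ?_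
    have := hN x
    omega
  -- Writing min(a, b) as the number of l below both exhibits the kernel as a Gram matrix.
  have hmin : ∀ a b : ℕ, a < N → b < N →
      ((min a b : ℕ) : ℤ) = ∑ l ∈ Finset.range N, if l < a ∧ l < b then 1 else 0 := by
    intro a b ha hb
    rw [Finset.sum_boole]
    congr 1
    rw [← Finset.card_range (min a b)]
    congr 1
    ext l
    simp only [Finset.mem_range, Finset.mem_filter]
    omega
  -- The quadratic form of the kernel at c is a sum of integer squares; by hypothesis it vanishes,
  -- so each square does.
  have key : ∑ q, ∑ l ∈ Finset.range N, (∑ x, if f x = q ∧ l < n x then c x else 0) ^ 2 = 0 := by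
    calc _ = ∑ q, ∑ l ∈ Finset.range N, ∑ x, ∑ y,
          (if f x = q ∧ l < n x then c x else 0) * (if f y = q ∧ l < n y then c y else 0) := by
          simp only [sq, Finset.sum_mul_sum]
      _ = ∑ q, ∑ x, ∑ y, ∑ l ∈ Finset.range N,
          (if f x = q ∧ l < n x then c x else 0) * (if f y = q ∧ l < n y then c y else 0) := by
          refine Finset.sum_congr rfl fun q _ => ?_
          rw [Finset.sum_comm]
          refine Finset.sum_congr rfl fun x _ => ?_
          rw [Finset.sum_comm]
      _ = ∑ x, ∑ y, ∑ q, ∑ l ∈ Finset.range N,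
          (if f x = q ∧ l < n x then c x else 0) * (if f y = q ∧ l < n y then c y else 0) := by
          rw [Finset.sum_comm]
          refine Finset.sum_congr rfl fun x _ => ?_
          rw [Finset.sum_comm]
      _ = ∑ x, c x * ∑ y, c y * (if f x = f y then (min (n x) (n y) : ℕ) else 0 : ℕ) := by
          refine Finset.sum_congr rfl fun x _ => ?_
          rw [Finset.mul_sum]
          refine Finset.sum_congr rfl fun y _ => ?_
          rw [Finset.sum_eq_single (f x)]
          · split_ifs with hxy
            · rw [hmin _ _ (hN x) (hN y), Finset.mul_sum, Finset.mul_sum]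
              refine Finset.sum_congr rfl fun l _ => ?_
              by_cases h1 : l < n x <;> by_cases h2 : l < n y <;> simp [h1, h2, hxy]
            · refine (Finset.sum_eq_zero fun l _ => ?_).trans (by simp)
              rw [if_neg (c := f y = f x ∧ l < n y) fun h => hxy h.1.symm, mul_zero]
          · intro q _ hq
            refine Finset.sum_eq_zero fun l _ => ?_
            rw [if_neg (c := f x = q ∧ l < n x) fun h => hq h.1.symm, zero_mul]
          · simp
      _ = 0 := Finset.sum_eq_zero fun x _ => by rw [h x, mul_zero]
  rw [Finset.sum_eq_zero_iff_of_nonneg fun q _ => Finset.sum_nonneg fun l _ => sq_nonneg _] at key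
  have h1 := key q (Finset.mem_univ q)
  rw [Finset.sum_eq_zero_iff_of_nonneg fun l _ => sq_nonneg _] at h1
  exact pow_eq_zero_iff two_ne_zero |>.1 (h1 l (Finset.mem_range.2 hl))

theorem card_lt_eq_card_add_card_lt {K Q : Type*} [Fintype K] [DecidableEq Q] (f : K → Q)
    (n : K → ℕ) (q : Q) (l : ℕ) :
    Fintype.card {i : K // f i = q ∧ l < n i} =
      Fintype.card {i : K // (f i, n i) = (q, l + 1)} +
        Fintype.card {i : K // f i = q ∧ l + 1 < n i} := by
  classical
  rw [Fintype.card_subtype, Fintype.card_subtype, Fintype.card_subtype,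
    ← Finset.card_union_of_disjoint]
  · congr 1
    ext i
    simp only [Finset.mem_filter, Finset.mem_univ, true_and, Finset.mem_union, Prod.mk.injEq]
    rw [← and_or_left]
    refine and_congr_right fun _ => ?_
    omega
  · rw [Finset.disjoint_filter]
    intro i _ hi hi'
    have := (Prod.ext_iff.1 hi).2
    simp only at this
    omega

/-- Two families of positive weights and classes agree up to a bijection if their pairings with all
members agree. -/
theorem exists_equiv_of_sum_min {I J Q : Type*} [Fintype I] [Fintype J] [Fintype Q]
    [DecidableEq Q] (f : I ⊕ J → Q) (n : I ⊕ J → ℕ) (hn : ∀ x, 0 < n x)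
    (h : ∀ x, ∑ i, (if f x = f (.inl i) then min (n x) (n (.inl i)) else 0) =
      ∑ j, (if f x = f (.inr j) then min (n x) (n (.inr j)) else 0)) :
    ∃ σ : I ≃ J, ∀ i, f (.inl i) = f (.inr (σ i)) ∧ n (.inl i) = n (.inr (σ i)) := by
  -- With weights +1 on I and -1 on J, vanishing says that the two families have equally many
  -- members of size above l in each class.
  have h1 := sum_ite_eq_zero_of_sum_min f n (Sum.elim (fun _ => 1) (fun _ => -1)) (by
    intro x
    rw [Fintype.sum_sum_type]
    simp only [Sum.elim_inl, Sum.elim_inr, one_mul, neg_mul, Finset.sum_neg_distrib]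
    rw [← Nat.cast_sum, ← Nat.cast_sum, h x, add_neg_cancel])
  have h2 : ∀ q l, Fintype.card {i : I // f (.inl i) = q ∧ l < n (.inl i)} =
      Fintype.card {j : J // f (.inr j) = q ∧ l < n (.inr j)} := by
    intro q l
    have := h1 q l
    rw [Fintype.sum_sum_type] at this
    simp only [Sum.elim_inl, Sum.elim_inr] at this
    rw [Fintype.card_subtype, Fintype.card_subtype]
    have h3 : ∑ j : J, (if f (.inr j) = q ∧ l < n (.inr j) then (-1 : ℤ) else 0) =
        - ∑ j : J, (if f (.inr j) = q ∧ l < n (.inr j) then (1 : ℤ) else 0) := by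
      rw [← Finset.sum_neg_distrib]
      exact Finset.sum_congr rfl fun j _ => by split_ifs <;> simp
    rw [h3, Finset.sum_boole, Finset.sum_boole] at this
    omega
  have h5 : ∀ c : Q × ℕ, Nonempty ({i : I // (f (.inl i), n (.inl i)) = c} ≃
      {j : J // (f (.inr j), n (.inr j)) = c}) := by
    rintro ⟨q, _ | l⟩
    -- Size 0 is excluded by positivity; the fibre of size l + 1 is a difference of consecutive tail
    -- counts.
    · have h6 : IsEmpty {i : I // (f (.inl i), n (.inl i)) = (q, 0)} :=
        ⟨fun i => (hn (.inl i.1)).ne' (Prod.ext_iff.1 i.2).2⟩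
      have h7 : IsEmpty {j : J // (f (.inr j), n (.inr j)) = (q, 0)} :=
        ⟨fun i => (hn (.inr i.1)).ne' (Prod.ext_iff.1 i.2).2⟩
      exact ⟨Equiv.equivOfIsEmpty _ _⟩
    · refine ⟨Fintype.equivOfCardEq ?_⟩
      have e1 := card_lt_eq_card_add_card_lt (fun i => f (.inl i)) (fun i => n (.inl i)) q l
      have e2 := card_lt_eq_card_add_card_lt (fun j => f (.inr j)) (fun j => n (.inr j)) q l
      have e3 := h2 q l
      have e4 := h2 q (l + 1)
      omega
  refine ⟨Equiv.ofFiberEquiv fun c => (h5 c).some, fun i => ?_⟩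
  have := Equiv.ofFiberEquiv_map (fun c => (h5 c).some) i
  exact ⟨(Prod.ext_iff.1 this).1.symm, (Prod.ext_iff.1 this).2.symm⟩

/-! ### Uniqueness of the decomposition into blocks. -/

namespace FormPair

variable {k : Type*} [Field k]

theorem finrank_adjointPairs_orthSum {K : Type*} [Fintype K] {W : K → Type*} {X : Type*}
    [∀ l, AddCommGroup (W l)] [∀ l, Module k (W l)] [∀ l, FiniteDimensional k (W l)]
    [AddCommGroup X] [Module k X] [FiniteDimensional k X] (B : ∀ l, FormPair k (W l))
    (C : FormPair k X) [∀ l, Decidable (Linked C (B l))] (hB : ∀ l, IsBlock (B l))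
    (hC : IsBlock C) :
    Module.finrank k (adjointPairs (orthSum B) C) = 2 * ∑ l, (if Linked C (B l) then
        min (Module.finrank k X) (Module.finrank k (W l)) else 0) := by
  classical
  obtain ⟨E⟩ := nonempty_adjointPairs_orthSum B C
  rw [E.finrank_eq, Module.finrank_pi_fintype, Finset.mul_sum]
  refine Finset.sum_congr rfl fun l _ => ?_
  obtain ⟨E'⟩ := nonempty_adjointPairs_swap (hB l).isAlt hC.isAlt
  rw [E'.finrank_eq, hC.finrank_adjointPairs (hB l), mul_ite, mul_zero]

/-- An indecomposable sloped pair of alternating forms, with its space. -/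
structure BlockObj (k : Type*) [Field k] where
  /-- the space -/
  V : Type*
  [addCommGroup : AddCommGroup V]
  [module : Module k V]
  [finite : FiniteDimensional k V]
  /-- the forms -/
  form : FormPair k V
  isBlock : IsBlock form

attribute [instance] BlockObj.addCommGroup BlockObj.module BlockObj.finite

/-- Being linked, as an equivalence relation. -/
def linkedSetoid (k : Type*) [Field k] : Setoid (BlockObj k) where
  r X Y := Linked X.form Y.form
  iseqv := ⟨fun X => X.isBlock.linked_refl, fun {X Y} => X.isBlock.linked_symm Y.isBlock,
    fun {X Y Z} => X.isBlock.linked_trans Y.isBlock Z.isBlock⟩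

/-- Uniqueness of decompositions into indecomposable sloped pairs. -/
theorem exists_equiv_of_isometric_orthSum.{u, w} {k : Type u} [Field k] {I J : Type*} [Fintype I]
    [Fintype J] (B : I → BlockObj.{u, w} k) (C : J → BlockObj.{u, w} k)
    (h : Isometric (orthSum fun i => (B i).form) (orthSum fun j => (C j).form)) :
    ∃ σ : I ≃ J, ∀ i, Isometric (B i).form (C (σ i)).form := by
  classical
  let F : I ⊕ J → BlockObj.{u, w} k := Sum.elim B C
  -- The relation is pulled back to the finite index set so that there are finitely many classes to
  -- sum over.
  let r : Setoid (I ⊕ J) := (linkedSetoid k).comap F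
  have hr : ∀ x y, (Quotient.mk r x = Quotient.mk r y) ↔ Linked (F x).form (F y).form := fun x y =>
    Quotient.eq (r := r)
  obtain ⟨σ, hσ⟩ := exists_equiv_of_sum_min (fun x => Quotient.mk r x)
    (fun x => Module.finrank k (F x).V)
    (fun x => by
      have := (F x).isBlock.isIndec.1
      exact Module.finrank_pos)
    (fun x => by
      -- Each block of either family serves as a test object: the two isometric sums have equally
      -- many adjoint pairs with it.
      obtain ⟨E⟩ := nonempty_adjointPairs_congr h (Isometric.refl (F x).form)
      have := E.finrank_eq
      rw [finrank_adjointPairs_orthSum _ _ (fun i => (B i).isBlock) (F x).isBlock,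
        finrank_adjointPairs_orthSum _ _ (fun j => (C j).isBlock) (F x).isBlock] at this
      simp only [hr]
      exact Nat.eq_of_mul_eq_mul_left two_pos this)
  exact ⟨σ, fun i => (B i).isBlock.isometric_of_linked (C (σ i)).isBlock ((hr _ _).1 (hσ i).1)
    (hσ i).2⟩

end FormPair

/-! ### Pfaffians, discriminants and characteristic polynomials. -/

namespace FormPair

open Polynomial

variable {k : Type*} [Field k] {V V' : Type*} [AddCommGroup V] [Module k V]
  [AddCommGroup V'] [Module k V']

/-- T is conjugate to multiplication by the root on two copies of k[X]/(μ), and on each copy the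
characteristic polynomial is μ. -/
theorem charpoly_of_isometric_model {B : FormPair k V} {μ : k[X]} {hμ : μ.Monic}
    [FiniteDimensional k V] (h : Isometric B (model hμ)) {T : Module.End k V}
    (hT : ∀ u v, B 0 u (T v) = B 1 u v) : T.charpoly = μ * μ := by
  have := hμ.finite_adjoinRoot
  have := hμ.free_adjoinRoot
  obtain ⟨e, he⟩ := h
  have hlmul : (Algebra.lmul k (AdjoinRoot μ) (AdjoinRoot.root μ)).charpoly = μ := by
    rw [← LinearMap.charpoly_toMatrix _ (AdjoinRoot.powerBasis' hμ).basis]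
    have := charpoly_leftMulMatrix (AdjoinRoot.powerBasis' hμ)
    rw [Algebra.leftMulMatrix_apply, AdjoinRoot.powerBasis'_gen] at this
    rw [this, AdjoinRoot.minpoly_root hμ.ne_zero, hμ.leadingCoeff]
    simp
  have hconj : e.conj T = (Algebra.lmul k (AdjoinRoot μ) (AdjoinRoot.root μ)).prodMap
      (Algebra.lmul k (AdjoinRoot μ) (AdjoinRoot.root μ)) := by
    refine LinearMap.ext fun u => ?_
    change _ = AdjoinRoot.root μ • u
    rw [← sub_eq_zero]
    refine eq_zero_of_forall_right (separatingLeft_model hμ) (isAlt_model hμ 0) fun v => ?_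
    rw [map_sub, ← model_zero_smul, ← model_one_apply, LinearEquiv.conj_apply_apply]
    have h0 := he 0 (e.symm v) (T (e.symm u))
    have h1 := he 1 (e.symm v) (e.symm u)
    rw [e.apply_symm_apply] at h0
    rw [e.apply_symm_apply, e.apply_symm_apply] at h1
    rw [h0, h1, hT, sub_self]
  rw [← e.charpoly_conj T, hconj, LinearMap.charpoly_prodMap, hlmul]

/-- The degree gives the dimension, and the only monic irreducible factor gives the prime; together
they determine the model. -/
theorem isometric_of_charpoly_eq [FiniteDimensional k V] [FiniteDimensional k V']
    {B : FormPair k V} {B' : FormPair k V'} {p q : k[X]} (h : HasType B p) (h' : HasType B' q)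
    {T : Module.End k V} (hT : ∀ u v, B 0 u (T v) = B 1 u v)
    {T' : Module.End k V'} (hT' : ∀ u v, B' 0 u (T' v) = B' 1 u v)
    (hc : T.charpoly = T'.charpoly) : Isometric B B' := by
  have hdim : Module.finrank k V = Module.finrank k V' := by
    rw [← T.charpoly_natDegree, ← T'.charpoly_natDegree, hc]
  obtain ⟨m, hpm, hp, hB⟩ := id h
  obtain ⟨l, hqm, hq, hB'⟩ := id h'
  rw [charpoly_of_isometric_model hB hT, charpoly_of_isometric_model hB' hT'] at hc
  have hd : p ∣ q := by
    have : p ∣ q ^ (l + 1) * q ^ (l + 1) := by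
      rw [← hc]
      exact ((dvd_pow_self p m.succ_ne_zero).mul_right _)
    rw [← pow_add] at this
    exact hp.prime.dvd_of_dvd_pow this
  obtain rfl := eq_of_monic_of_associated hpm hqm (hp.associated_of_dvd hq hd)
  exact isometric_of_hasType h h' hdim

/-- The pair of bilinear forms on coordinate space given by a pair of matrices. -/
noncomputable def ofMatrices {ι : Type*} [Fintype ι] [DecidableEq ι] (Φ : Fin 2 → Matrix ι ι k) :
    FormPair k (ι → k) := fun i => Matrix.toBilin' (Φ i)

variable {ι κ : Type*} [Fintype ι] [DecidableEq ι] [Fintype κ] [DecidableEq κ]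

theorem ofMatrices_apply (Φ : Fin 2 → Matrix ι ι k) (i : Fin 2) (u v : ι → k) :
    ofMatrices Φ i u v = pairBimap Φ u v i := Matrix.toBilin'_apply' _ _ _

theorem isSlope_ofMatrices {Φ : Fin 2 → Matrix ι ι k} {a b : k} :
    IsSlope (ofMatrices Φ) a b ↔ (a • Φ 0 + b • Φ 1).det ≠ 0 := by
  rw [← LinearMap.BilinForm.nondegenerate_toBilin'_iff_det_ne_zero, map_add, map_smul, map_smul]
  exact ⟨fun h => LinearMap.BilinForm.Nondegenerate.ofSeparatingLeft h, fun h => h.1⟩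

theorem isBlock_ofMatrices {Φ : Fin 2 → Matrix ι ι k} (h : IsAltPair Φ) (h' : IsIndecPair Φ)
    (h'' : IsSlopedPair Φ) : IsBlock (ofMatrices Φ) where
  isAlt := fun i u => by rw [ofMatrices_apply, h u, Pi.zero_apply]
  isIndec := by
    have hskew : ∀ u v, pairBimap Φ u v = 0 → pairBimap Φ v u = 0 := by
      intro u v huv
      funext i
      have e0 := congrFun (h (u + v)) i
      have e1 := congrFun (h u) i
      have e2 := congrFun (h v) i
      have e3 := congrFun huv i
      simp only [← ofMatrices_apply, map_add, LinearMap.add_apply, Pi.zero_apply] at e0 e1 e2 e3 ⊢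
      rw [e1, e2, e3] at e0
      simpa using e0
    have := h'.1
    refine ⟨inferInstance, fun U W hUW ho => h'.2 U W hUW fun u hu w hw => ?_⟩
    have h0 : pairBimap Φ u w = 0 := funext fun i => by
      rw [← ofMatrices_apply, ho u hu w hw, Pi.zero_apply]
    exact ⟨h0, hskew _ _ h0⟩
  sloped := by
    obtain ⟨a, b, hab⟩ := h''
    exact ⟨a, b, isSlope_ofMatrices.2 hab⟩

/-- The two factors of the model are totally isotropic for both forms and remain so for their
combinations, so bases of the two factors give the required block shape. -/
theorem exists_isGenPfaffian {Φ : Fin 2 → Matrix ι ι k} (h : IsBlock (ofMatrices Φ)) :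
    ∃ f, IsGenPfaffian Φ f := by
  obtain ⟨a, b, hab⟩ := h.sloped
  obtain ⟨g, hg, rfl, rfl⟩ := exists_matrix_row (h.ne_zero_of_isSlope hab)
  obtain ⟨p, m, hpm, hp, e, he⟩ := h.exists_hasType_combo hg hab
  set c := (AdjoinRoot.powerBasis' (hpm.pow (m + 1))).basis
  set b := (c.prod c).map e.symm with hb
  have hl : ∀ i x y, ofMatrices Φ i (b (.inl x)) (b (.inl y)) = 0 := by
    intro i x y
    have : ∀ i, combo g (ofMatrices Φ) i (b (.inl x)) (b (.inl y)) = 0 := fun i => by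
      rw [← he]
      simp [hb, model_apply]
    rw [← combo_inv_combo hg (ofMatrices Φ), combo_apply, this, this, mul_zero, mul_zero, add_zero]
  have hr : ∀ i x y, ofMatrices Φ i (b (.inr x)) (b (.inr y)) = 0 := by
    intro i x y
    have : ∀ i, combo g (ofMatrices Φ) i (b (.inr x)) (b (.inr y)) = 0 := fun i => by
      rw [← he]
      simp [hb, model_apply]
    rw [← combo_inv_combo hg (ofMatrices Φ), combo_apply, this, this, mul_zero, mul_zero, add_zero]
  refine ⟨_, _, b, fun i => Matrix.of fun x y => ofMatrices Φ i (b (.inl x)) (b (.inr y)),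
    fun i => ?_, rfl⟩
  ext (x | x) (y | y)
  · simpa [← ofMatrices_apply] using hl i x y
  · simp [← ofMatrices_apply]
  · simpa [← ofMatrices_apply] using h.isAlt.swap i _ _
  · simpa [← ofMatrices_apply] using hr i x y

theorem Isometric.isGenPfaffian {Φ : Fin 2 → Matrix ι ι k} {Λ : Fin 2 → Matrix κ κ k}
    (h : Isometric (ofMatrices Φ) (ofMatrices Λ)) {f : MvPolynomial (Fin 2) k}
    (hf : IsGenPfaffian Φ f) : IsGenPfaffian Λ f := by
  obtain ⟨e, he⟩ := h
  obtain ⟨n, b, Ψ, hΨ, rfl⟩ := hf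
  refine ⟨n, b.map e, Ψ, fun i => ?_, rfl⟩
  rw [← hΨ]
  ext x y
  simp only [Matrix.of_apply, Module.Basis.map_apply, ← ofMatrices_apply, he]

theorem aeval_genDisc {R : Type*} [CommRing R] [Algebra k R] (x : Fin 2 → R)
    (Φ : Fin 2 → Matrix ι ι k) : MvPolynomial.aeval x (genDisc Φ) =
      (∑ i, x i • (Φ i).map (algebraMap k R)).det := by
  rw [genDisc, AlgHom.map_det]
  congr 1
  ext a b
  simp [Fin.sum_univ_two]

theorem isSlope_iff_aeval_genDisc {Φ : Fin 2 → Matrix ι ι k} {a b : k} :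
    IsSlope (ofMatrices Φ) a b ↔ MvPolynomial.aeval ![a, b] (genDisc Φ) ≠ 0 := by
  rw [isSlope_ofMatrices, aeval_genDisc]
  simp [Fin.sum_univ_two, Algebra.algebraMap_self]

theorem IsGenPfaffian.eqModScalars_sq {Φ : Fin 2 → Matrix ι ι k} {f : MvPolynomial (Fin 2) k}
    (hf : IsGenPfaffian Φ f) : EqModScalars (f ^ 2) (genDisc Φ) := by
  obtain ⟨n, b, Ψ, h, rfl⟩ := hf
  obtain ⟨-, δ, hδ, e⟩ := genDisc_sq Φ n b Ψ h
  have hC : (MvPolynomial.C δ⁻¹ * MvPolynomial.C δ : MvPolynomial (Fin 2) k) = 1 := by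
    rw [← map_mul, inv_mul_cancel₀ hδ, map_one]
  have hJ := Matrix.J_det_mul_J_det (Fin n) (MvPolynomial (Fin 2) k)
  -- The determinant of J squares to 1 in a domain, hence is the constant 1 or -1.
  obtain ⟨c, hc, hcJ⟩ : ∃ c : k, c ≠ 0 ∧
      (Matrix.J (Fin n) (MvPolynomial (Fin 2) k)).det = MvPolynomial.C c := by
    rcases mul_self_eq_one_iff.1 hJ with h1 | h1
    · exact ⟨1, one_ne_zero, by rw [h1, map_one]⟩
    · exact ⟨-1, neg_ne_zero.2 one_ne_zero, by rw [h1, map_neg, map_one]⟩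
  rw [hcJ] at e
  refine ⟨δ⁻¹ ^ 2 * c, mul_ne_zero (pow_ne_zero _ (inv_ne_zero hδ)) hc, ?_⟩
  rw [map_mul, map_pow, mul_assoc, mul_comm (MvPolynomial.C c), e, ← mul_assoc, ← mul_pow, hC,
    one_pow, one_mul]

theorem eqModScalars_genDisc {Φ : Fin 2 → Matrix ι ι k} {Λ : Fin 2 → Matrix κ κ k}
    {f g : MvPolynomial (Fin 2) k} (hf : IsGenPfaffian Φ f) (hg : IsGenPfaffian Λ g)
    (hfg : EqModScalars f g) : EqModScalars (genDisc Φ) (genDisc Λ) := by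
  obtain ⟨c, hc, rfl⟩ := hfg
  obtain ⟨a, ha, hf⟩ := IsGenPfaffian.eqModScalars_sq hf
  obtain ⟨b, hb, hg⟩ := IsGenPfaffian.eqModScalars_sq hg
  refine ⟨b * c ^ 2 * a⁻¹, mul_ne_zero (mul_ne_zero hb (pow_ne_zero _ hc)) (inv_ne_zero ha), ?_⟩
  have hC : (MvPolynomial.C a⁻¹ * MvPolynomial.C a : MvPolynomial (Fin 2) k) = 1 := by
    rw [← map_mul, inv_mul_cancel₀ ha, map_one]
  rw [hf, hg, map_mul, map_mul, map_pow]
  linear_combination (-MvPolynomial.C b * MvPolynomial.C c ^ 2 * f ^ 2) * hC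

theorem combo_ofMatrices (g : Matrix (Fin 2) (Fin 2) k) (Φ : Fin 2 → Matrix ι ι k) :
    combo g (ofMatrices Φ) = ofMatrices fun i => ∑ j, g i j • Φ j := by
  funext i
  simp [combo, ofMatrices]

/-- Take T = M₀⁻¹M₁ and factor M₀ out of XM₀ - M₁. -/
theorem exists_operator {M : Fin 2 → Matrix ι ι k} (h : (M 0).det ≠ 0) :
    ∃ T : Module.End k (ι → k), (∀ u v, ofMatrices M 0 u (T v) = ofMatrices M 1 u v) ∧
      ((X : k[X]) • (M 0).map C - (M 1).map C).det = C (M 0).det * T.charpoly := by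
  refine ⟨Matrix.toLin' ((M 0)⁻¹ * M 1), fun u v => ?_, ?_⟩
  · rw [ofMatrices_apply, ofMatrices_apply, pairBimap, pairBimap, Matrix.toLin'_apply,
      Matrix.mulVec_mulVec, ← mul_assoc, Matrix.mul_nonsing_inv _ (isUnit_iff_ne_zero.2 h),
      one_mul]
  · rw [Matrix.charpoly_toLin', Matrix.charpoly, RingHom.map_det, ← Matrix.det_mul]
    congr 1
    have : (C : k →+* k[X]).mapMatrix (M 0) * (C : k →+* k[X]).mapMatrix ((M 0)⁻¹ * M 1) =
        (C : k →+* k[X]).mapMatrix (M 1) := by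
      rw [← map_mul, ← mul_assoc, Matrix.mul_nonsing_inv _ (isUnit_iff_ne_zero.2 h), one_mul]
    rw [Matrix.charmatrix, mul_sub, this, Matrix.scalar_apply, ← Matrix.smul_one_eq_diagonal,
      mul_smul_comm, mul_one]
    rfl

/-- Blocks with the same discriminant up to scalars are isometric. -/
theorem isometric_of_genDisc {Φ : Fin 2 → Matrix ι ι k} {Λ : Fin 2 → Matrix κ κ k}
    (hΦ : IsBlock (ofMatrices Φ)) (hΛ : IsBlock (ofMatrices Λ))
    (h : EqModScalars (genDisc Φ) (genDisc Λ)) : Isometric (ofMatrices Φ) (ofMatrices Λ) := by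
  obtain ⟨c, hc, hcg⟩ := h
  obtain ⟨a, b, hab⟩ := hΦ.sloped
  -- The discriminant at (a, b) is the determinant of that combination, so proportional
  -- discriminants have the same slopes.
  have hab' : IsSlope (ofMatrices Λ) a b := by
    rw [isSlope_iff_aeval_genDisc] at hab ⊢
    rw [hcg, map_mul, MvPolynomial.aeval_C]
    exact mul_ne_zero hc hab
  obtain ⟨g, hg, rfl, rfl⟩ := exists_matrix_row (hΦ.ne_zero_of_isSlope hab)
  obtain ⟨p, hp⟩ := hΦ.exists_hasType_combo hg hab
  obtain ⟨q, hq⟩ := hΛ.exists_hasType_combo hg hab'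
  have hdet : (∑ j, g 0 j • Φ j).det ≠ 0 := by
    rw [Fin.sum_univ_two]
    exact isSlope_ofMatrices.1 hab
  have hdet' : (∑ j, g 0 j • Λ j).det ≠ 0 := by
    rw [Fin.sum_univ_two]
    exact isSlope_ofMatrices.1 hab'
  rw [combo_ofMatrices] at hp hq
  obtain ⟨T, hT, hTc⟩ := exists_operator (M := fun i => ∑ j, g i j • Φ j) hdet
  obtain ⟨S, hS, hSc⟩ := exists_operator (M := fun i => ∑ j, g i j • Λ j) hdet'
  rw [← isometric_combo_iff hg, combo_ofMatrices, combo_ofMatrices]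
  refine isometric_of_charpoly_eq hp hq hT hS ?_
  have hx : ∀ x : Fin 2 → k[X], MvPolynomial.aeval x (genDisc Λ) =
      C c * MvPolynomial.aeval x (genDisc Φ) := by
    intro x
    rw [hcg, map_mul, MvPolynomial.aeval_C]
    rfl
  -- This substitution turns the pencil xΦ₁ + yΦ₂ into X times the new first matrix minus the new
  -- second one, whose determinant is a constant times a characteristic polynomial.
  have h1 := hx fun j => X * C (g 0 j) - C (g 1 j)
  have h2 : (∑ j, (X * C (g 0 j) - C (g 1 j)) • (Φ j).map (algebraMap k k[X])) =
      (X : k[X]) • (∑ j, g 0 j • Φ j).map C - (∑ j, g 1 j • Φ j).map C := by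
    ext1 x y
    simp [Fin.sum_univ_two]
    ring
  have h3 : (∑ j, (X * C (g 0 j) - C (g 1 j)) • (Λ j).map (algebraMap k k[X])) =
      (X : k[X]) • (∑ j, g 0 j • Λ j).map C - (∑ j, g 1 j • Λ j).map C := by
    ext1 x y
    simp [Fin.sum_univ_two]
    ring
  rw [aeval_genDisc, aeval_genDisc, h2, h3, hTc, hSc, ← mul_assoc, ← C_mul] at h1
  refine (eq_of_monic_of_associated S.charpoly_monic T.charpoly_monic ?_).symm
  refine Associated.trans (associated_unit_mul_right _ _ (isUnit_C.2 (isUnit_iff_ne_zero.2 hdet'))) ?_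
  rw [h1]
  exact (associated_unit_mul_left _ _
    (isUnit_C.2 (isUnit_iff_ne_zero.2 (mul_ne_zero hc hdet))))

end FormPair

/-! ### Twisting a pair of matrices by an element of ΓL(2, k). -/

namespace GammaL2

variable {k : Type*} [Field k] {ι κ : Type*} [Fintype ι] [Fintype κ]

/-- The pair of matrices representing the bimap `(u, v) ↦ (u^{τ⁻¹} ∘ v^{τ⁻¹}) A`. -/
def twist (A : GammaL2 k) (Φ : Fin 2 → Matrix ι ι k) : Fin 2 → Matrix ι ι k :=
  fun i => ∑ j, (A.mat : Matrix (Fin 2) (Fin 2) k) j i • (Φ j).map A.aut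

/-- The coordinatewise action of a field automorphism. -/
def coordMap (ι : Type*) (τ : k ≃+* k) :
    letI := RingHomInvPair.of_ringEquiv τ
    letI := RingHomInvPair.of_ringEquiv_symm τ
    (ι → k) ≃ₛₗ[(τ : k →+* k)] (ι → k) :=
  letI := RingHomInvPair.of_ringEquiv τ
  letI := RingHomInvPair.of_ringEquiv_symm τ
  { toFun := fun u i => τ (u i)
    invFun := fun u i => τ.symm (u i)
    map_add' := fun u v => by funext i; simp
    map_smul' := fun c u => by funext i; simp
    left_inv := fun u => by funext i; simp
    right_inv := fun u => by funext i; simp }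

theorem act_zero (A : GammaL2 k) : A.act 0 = 0 := by
  funext i
  simp [act, Matrix.vecMul, dotProduct]

theorem act_smul (A : GammaL2 k) (c : k) (w : Fin 2 → k) : A.act (c • w) = A.aut c • A.act w := by
  simp only [act, ← Matrix.smul_vecMul]
  congr 1
  funext i
  simp

theorem act_ne_zero (A : GammaL2 k) {w : Fin 2 → k} (hw : w ≠ 0) : A.act w ≠ 0 := by
  intro h
  apply hw
  have h1 : (fun i => A.aut (w i)) = 0 := by
    apply Matrix.vecMul_injective_of_isUnit (A.mat.isUnit)
    simpa [act] using h
  funext i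
  simpa using congrFun h1 i

theorem pairBimap_twist (A : GammaL2 k) (Φ : Fin 2 → Matrix ι ι k) (u v : ι → k) :
    pairBimap (A.twist Φ) (fun i => A.aut (u i)) (fun i => A.aut (v i)) =
      A.act (pairBimap Φ u v) := by
  have h : ∀ j, (fun i => A.aut (u i)) ⬝ᵥ ((Φ j).map A.aut *ᵥ fun i => A.aut (v i)) =
      A.aut (u ⬝ᵥ (Φ j *ᵥ v)) := by
    intro j
    simp [dotProduct, Matrix.mulVec, map_sum]
  funext i
  have h' : A.act (pairBimap Φ u v) i =
      A.aut (u ⬝ᵥ (Φ 0 *ᵥ v)) * (A.mat : Matrix (Fin 2) (Fin 2) k) 0 i +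
        A.aut (u ⬝ᵥ (Φ 1 *ᵥ v)) * (A.mat : Matrix (Fin 2) (Fin 2) k) 1 i :=
    Fin.sum_univ_two fun j => A.aut (pairBimap Φ u v j) * (A.mat : Matrix (Fin 2) (Fin 2) k) j i
  rw [h', pairBimap, twist, Fin.sum_univ_two, Matrix.add_mulVec, Matrix.smul_mulVec,
    Matrix.smul_mulVec, dotProduct_add, dotProduct_smul, dotProduct_smul, h, h, smul_eq_mul,
    smul_eq_mul]
  ring

theorem pairBimap_twist' (A : GammaL2 k) (Φ : Fin 2 → Matrix ι ι k) (u v : ι → k) :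
    pairBimap (A.twist Φ) u v =
      A.act (pairBimap Φ (fun i => A.aut.symm (u i)) (fun i => A.aut.symm (v i))) := by
  rw [← pairBimap_twist]
  simp

theorem isAltPair_twist (A : GammaL2 k) {Φ : Fin 2 → Matrix ι ι k} (h : IsAltPair Φ) :
    IsAltPair (A.twist Φ) := by
  intro u
  rw [pairBimap_twist', h, act_zero]

/-- Applying τ to coordinates is an automorphism of the subspace lattice, and the action on k² is
injective, so orthogonal splittings correspond. -/
theorem isIndecPair_twist (A : GammaL2 k) {Φ : Fin 2 → Matrix ι ι k} (h : IsIndecPair Φ) :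
    IsIndecPair (A.twist Φ) := by
  have := RingHomInvPair.of_ringEquiv A.aut
  have := RingHomInvPair.of_ringEquiv_symm A.aut
  refine ⟨h.1, fun U W hUW ho => ?_⟩
  let E : Submodule k (ι → k) ≃o Submodule k (ι → k) :=
    Submodule.orderIsoMapComap (coordMap ι A.aut)
  have hmem : ∀ (U : Submodule k (ι → k)) u, u ∈ E.symm U ↔ (fun i => A.aut (u i)) ∈ U :=
    fun U u => Iff.rfl
  have := h.2 (E.symm U) (E.symm W) (E.symm.isCompl hUW) (fun u hu w hw => by
    rw [hmem] at hu hw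
    have := ho _ hu _ hw
    rw [pairBimap_twist, pairBimap_twist] at this
    by_contra hcon
    rw [not_and_or] at hcon
    exact hcon.elim (fun hc => A.act_ne_zero hc this.1) (fun hc => A.act_ne_zero hc this.2))
  simpa using this

theorem isSlopedPair_twist [DecidableEq ι] (A : GammaL2 k) {Φ : Fin 2 → Matrix ι ι k}
    (h : IsSlopedPair Φ) : IsSlopedPair (A.twist Φ) := by
  obtain ⟨a, b, hab⟩ := h
  set M : Matrix (Fin 2) (Fin 2) k := ↑A.mat with hM
  have hMdet : IsUnit M.det := (Matrix.isUnit_iff_isUnit_det M).1 A.mat.isUnit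
  -- Solving Mx = (τ(a), τ(b)) makes this combination of the twisted pair the image under τ of the
  -- given nondegenerate one.
  set x : Fin 2 → k := M⁻¹ *ᵥ ![A.aut a, A.aut b] with hx
  have hMx : M *ᵥ x = ![A.aut a, A.aut b] := by
    rw [hx, Matrix.mulVec_mulVec, Matrix.mul_nonsing_inv _ hMdet, Matrix.one_mulVec]
  have h0 : M 0 0 * x 0 + M 0 1 * x 1 = A.aut a := by
    simpa [Matrix.mulVec, dotProduct, Fin.sum_univ_two] using congrFun hMx 0
  have h1 : M 1 0 * x 0 + M 1 1 * x 1 = A.aut b := by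
    simpa [Matrix.mulVec, dotProduct, Fin.sum_univ_two] using congrFun hMx 1
  refine ⟨x 0, x 1, ?_⟩
  have : x 0 • A.twist Φ 0 + x 1 • A.twist Φ 1 =
      (A.aut : k →+* k).mapMatrix (a • Φ 0 + b • Φ 1) := by
    ext p q
    simp only [twist, ← hM, Fin.sum_univ_two, Matrix.add_apply, Matrix.smul_apply, Matrix.map_apply,
      smul_eq_mul, RingHom.mapMatrix_apply, map_add, map_mul, RingHom.coe_coe, ← h0, ← h1]
    ring
  rw [this, ← RingHom.map_det]
  simpa using hab

/-- Collecting the twisted pencil by the matrices τ(Ψⱼ) gives them the linear forms of row j of M as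
coefficients, which is precisely the substitution of the polynomial action. -/
theorem genDisc_twist [DecidableEq ι] (A : GammaL2 k) (Ψ : Fin 2 → Matrix ι ι k) :
    genDisc (A.twist Ψ) = A.polyAct (genDisc Ψ) := by
  let φ : MvPolynomial (Fin 2) k →+* MvPolynomial (Fin 2) k :=
    (MvPolynomial.bind₁ (fun i =>
      MvPolynomial.C ((A.mat : Matrix (Fin 2) (Fin 2) k) i 0) * MvPolynomial.X 0 +
      MvPolynomial.C ((A.mat : Matrix (Fin 2) (Fin 2) k) i 1) * MvPolynomial.X 1)).toRingHom.comp
      (MvPolynomial.map (A.aut : k →+* k))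
  change _ = φ (genDisc Ψ)
  rw [genDisc, genDisc, RingHom.map_det]
  congr 1
  ext1 p q
  simp [φ, twist, Fin.sum_univ_two]
  ring

theorem isGenPfaffian_twist (A : GammaL2 k) {Φ : Fin 2 → Matrix ι ι k}
    {f : MvPolynomial (Fin 2) k} (hf : IsGenPfaffian Φ f) :
    IsGenPfaffian (A.twist Φ) (A.polyAct f) := by
  obtain ⟨n, b, Ψ, h, rfl⟩ := hf
  have := RingHomInvPair.of_ringEquiv A.aut
  have := RingHomInvPair.of_ringEquiv_symm A.aut
  -- Conjugating the coordinate map of b by τ gives a linear map; it is the coordinate map of the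
  -- basis obtained by applying τ to the entries of the vectors of b.
  let E : (ι → k) ≃ₗ[k] (Fin n ⊕ Fin n → k) :=
    (coordMap ι A.aut).symm.trans (b.equivFun.trans (coordMap (Fin n ⊕ Fin n) A.aut))
  have hb : ∀ p, Module.Basis.ofEquivFun E p = fun i => A.aut (b p i) := by
    classical
    intro p
    rw [Module.Basis.coe_ofEquivFun, LinearEquiv.symm_apply_eq]
    change _ = fun x => A.aut (b.equivFun (fun i => A.aut.symm (A.aut (b p i))) x)
    simp only [RingEquiv.symm_apply_apply]
    funext x
    rw [b.equivFun_self]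
    by_cases hx : p = x
    · subst hx
      simp
    · simp [hx, Ne.symm hx]
  refine ⟨n, Module.Basis.ofEquivFun E, A.twist Ψ, fun i => ?_, (genDisc_twist A Ψ).symm⟩
  have hval : ∀ p q j, pairBimap Φ (b p) (b q) j =
      Matrix.fromBlocks 0 (Ψ j) (-(Ψ j)ᵀ) 0 p q := fun p q j => by
    rw [← h]
    rfl
  ext p q
  rw [Matrix.of_apply, hb, hb, pairBimap_twist, act]
  simp only [Matrix.vecMul, dotProduct, Fin.sum_univ_two, hval]
  rcases p with p | p <;> rcases q with q | q <;>
    simp [twist, Fin.sum_univ_two] <;> ring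

theorem twist_diagPair (A : GammaL2 k) {s : ℕ} {d : Fin s → ℕ}
    (Φ : ∀ j : Fin s, Fin 2 → Matrix (Fin (d j)) (Fin (d j)) k) :
    A.twist (diagPair Φ) = diagPair fun j => A.twist (Φ j) := by
  funext i
  ext ⟨x, a⟩ ⟨y, b⟩
  simp only [twist, diagPair, Fin.sum_univ_two, Matrix.add_apply, Matrix.smul_apply,
    Matrix.map_apply, Matrix.blockDiagonal'_apply, smul_eq_mul]
  split_ifs with hxy
  · subst hxy
    simp
  · simp

end GammaL2

/-! ### Reduction to isometries and the main theorem. -/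

open GammaL2 FormPair

/-- A pseudo-isometry over `A` is the same as an isometry from the twisted pair. -/
theorem liftsToPseudoIsometry_iff {k : Type*} [Field k] {ι κ : Type*} [Fintype ι] [DecidableEq ι]
    [Fintype κ] [DecidableEq κ] (A : GammaL2 k) (Φ : Fin 2 → Matrix ι ι k)
    (Λ : Fin 2 → Matrix κ κ k) :
    LiftsToPseudoIsometry A Φ Λ ↔ Isometric (ofMatrices (A.twist Φ)) (ofMatrices Λ) := by
  constructor
  · rintro ⟨ρ, α, hα, h⟩
    have := RingHomInvPair.of_ringEquiv ρ
    have := RingHomInvPair.of_ringEquiv_symm ρ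
    let e : (ι → k) ≃ₗ[k] (κ → k) :=
      (coordMap ι ρ).symm.trans (LinearEquiv.ofBijective α hα)
    have he : ∀ u, e u = α fun i => ρ.symm (u i) := fun u => rfl
    refine ⟨e, fun i u v => ?_⟩
    rw [ofMatrices_apply, ofMatrices_apply, he, he, h, pairBimap_twist']
    -- A zero bimap is compatible with every ρ. A nonzero value, scaled in the first argument,
    -- forces ρ to be the automorphism of A.
    by_cases hz : ∀ u v, pairBimap Φ u v = 0
    · rw [hz, hz]
    · push Not at hz
      obtain ⟨x, y, hxy⟩ := hz
      have hρ : ρ = A.aut := by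
        ext c
        have h1 := h (c • x) y
        have hl : ∀ {ι : Type _} [Fintype ι] (Φ : Fin 2 → Matrix ι ι k) (c : k) (u v : ι → k),
            pairBimap Φ (c • u) v = c • pairBimap Φ u v := fun Φ c u v => by
          funext i
          simp [pairBimap]
        have hl' : ∀ (c : k) (u v : κ → k),
            pairBimap Λ (c • u) v = c • pairBimap Λ u v := fun c u v => by
          funext i
          simp [pairBimap]
        rw [α.map_smulₛₗ, hl', hl, act_smul, h] at h1
        exact smul_left_injective k (A.act_ne_zero hxy) h1
      rw [hρ]
  · rintro ⟨e, he⟩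
    have := RingHomInvPair.of_ringEquiv A.aut
    have := RingHomInvPair.of_ringEquiv_symm A.aut
    refine ⟨A.aut, ((coordMap ι A.aut).trans e : (ι → k) ≃ₛₗ[(A.aut : k →+* k)] (κ → k)),
      LinearEquiv.bijective _, fun u v => ?_⟩
    rw [← pairBimap_twist]
    funext i
    rw [← ofMatrices_apply, ← ofMatrices_apply, ← he]
    rfl

theorem isometric_diagPair {k : Type*} [Field k] {s : ℕ} {d : Fin s → ℕ}
    (Φ : ∀ j : Fin s, Fin 2 → Matrix (Fin (d j)) (Fin (d j)) k) :
    Isometric (ofMatrices (diagPair Φ)) (orthSum fun j => ofMatrices (Φ j)) := by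
  let e : ((Σ j, Fin (d j)) → k) ≃ₗ[k] (∀ j, Fin (d j) → k) :=
    { Equiv.piCurry (fun _ _ => k) with
      map_add' := fun _ _ => rfl
      map_smul' := fun _ _ => rfl }
  refine ⟨e, fun i u v => ?_⟩
  have he : ∀ u j a, e u j a = u ⟨j, a⟩ := fun u j a => rfl
  rw [orthSum_apply, ofMatrices_apply]
  simp only [ofMatrices_apply, pairBimap, diagPair, dotProduct, Matrix.mulVec, he,
    Fintype.sum_sigma]
  refine Finset.sum_congr rfl fun x _ => Finset.sum_congr rfl fun a _ => ?_
  congr 1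
  rw [Finset.sum_eq_single x]
  · simp
  · intro y _ hy
    refine Finset.sum_eq_zero fun b _ => ?_
    rw [Matrix.blockDiagonal'_apply_ne _ _ _ (Ne.symm hy), zero_mul]
  · simp

/-- Pseudo-isometry of blocks is detected by the generalized Pfaffians. -/
theorem isometric_twist_iff {k : Type*} [Field k] {ι κ : Type*} [Fintype ι] [DecidableEq ι]
    [Fintype κ] [DecidableEq κ] (A : GammaL2 k) {Φ : Fin 2 → Matrix ι ι k}
    {Λ : Fin 2 → Matrix κ κ k} (hΦ : IsBlock (ofMatrices Φ))
    (hA : IsBlock (ofMatrices (A.twist Φ))) (hΛ : IsBlock (ofMatrices Λ)) :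
    Isometric (ofMatrices (A.twist Φ)) (ofMatrices Λ) ↔
      ∃ f g : MvPolynomial (Fin 2) k, IsGenPfaffian Φ f ∧ IsGenPfaffian Λ g ∧
        EqModScalars (A.polyAct f) g := by
  constructor
  · intro h
    obtain ⟨f, hf⟩ := exists_isGenPfaffian hΦ
    exact ⟨f, A.polyAct f, hf, h.isGenPfaffian (A.isGenPfaffian_twist hf), 1, one_ne_zero, by simp⟩
  · rintro ⟨f, g, hf, hg, hfg⟩
    exact isometric_of_genDisc hA hΛ
      (eqModScalars_genDisc (A.isGenPfaffian_twist hf) hg hfg)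

theorem theorem3p14 {k : Type*} [Field k] {s t : ℕ} {d : Fin s → ℕ} {e : Fin t → ℕ}
    (Φ : ∀ j : Fin s, Fin 2 → Matrix (Fin (d j)) (Fin (d j)) k)
    (Λ : ∀ j : Fin t, Fin 2 → Matrix (Fin (e j)) (Fin (e j)) k)
    (hΦalt : ∀ j, IsAltPair (Φ j)) (hΛalt : ∀ j, IsAltPair (Λ j))
    (hΦind : ∀ j, IsIndecPair (Φ j)) (hΛind : ∀ j, IsIndecPair (Λ j))
    (hΦslo : ∀ j, IsSlopedPair (Φ j)) (hΛslo : ∀ j, IsSlopedPair (Λ j))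
    (αhat : GammaL2 k) :
    LiftsToPseudoIsometry αhat (diagPair Φ) (diagPair Λ) ↔
      ∃ (h : s = t) (σ : Equiv.Perm (Fin s)), ∀ i : Fin s,
        ∃ f g : MvPolynomial (Fin 2) k,
          IsGenPfaffian (Φ i) f ∧ IsGenPfaffian (Λ (Fin.cast h (σ i))) g ∧
            EqModScalars (αhat.polyAct f) g := by
  have hΦ : ∀ j, IsBlock (ofMatrices (Φ j)) := fun j =>
    isBlock_ofMatrices (hΦalt j) (hΦind j) (hΦslo j)
  have hA : ∀ j : Fin s, IsBlock (ofMatrices (ι := Fin (d j)) (αhat.twist (Φ j))) := fun j =>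
    isBlock_ofMatrices (αhat.isAltPair_twist (hΦalt j)) (αhat.isIndecPair_twist (hΦind j))
      (αhat.isSlopedPair_twist (hΦslo j))
  have hΛ : ∀ j, IsBlock (ofMatrices (ι := Fin (e j)) (Λ j)) := fun j =>
    isBlock_ofMatrices (hΛalt j) (hΛind j) (hΛslo j)
  have hsum : LiftsToPseudoIsometry αhat (diagPair Φ) (diagPair Λ) ↔
      Isometric (orthSum fun j => ofMatrices (ι := Fin (d j)) (αhat.twist (Φ j)))
        (orthSum fun j => ofMatrices (ι := Fin (e j)) (Λ j)) := by
    rw [liftsToPseudoIsometry_iff, twist_diagPair]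
    exact ⟨fun h => (isometric_diagPair _).symm.trans (h.trans (isometric_diagPair Λ)),
      fun h => (isometric_diagPair _).trans (h.trans (isometric_diagPair Λ).symm)⟩
  rw [hsum]
  constructor
  · intro h
    obtain ⟨σ, hσ⟩ := exists_equiv_of_isometric_orthSum
      (fun i => ⟨Fin (d i) → k, ofMatrices (αhat.twist (Φ i)), hA i⟩)
      (fun j => ⟨Fin (e j) → k, ofMatrices (Λ j), hΛ j⟩) h
    have hst : s = t := by simpa using Fintype.card_congr σ
    subst hst
    exact ⟨rfl, σ, fun i => (isometric_twist_iff αhat (hΦ i) (hA i) (hΛ (σ i))).1 (hσ i)⟩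
  · rintro ⟨rfl, σ, hσ⟩
    exact Isometric.orthSum σ fun i =>
      (isometric_twist_iff αhat (hΦ i) (hA i) (hΛ (σ i))).2 (hσ i)
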